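/- Let $\mathcal U$ be a unital of even order $n\ge 4$, i.e. a $2$-$(n^3+1,n+1,1)$ design whose blocks are called lines, satisfying Wilbrink's conditions: (I) $\mathcal U$ contains no O'Nan configuration, i.e. no four distinct lines intersecting in six distinct points. (II) If $x$ is a point, $L$ a line through $x$, and $M$ a line missing $x$ which meets $L$, then for every point $y'\in L\setminus\{x\}$ there is a line $M'$ through $y'$ but not through $x$ which meets all the lines through $x$ that meet $M$. For a point $x$, two lines $M,M'$ missing $x$ are $x$-parallel, written $M\parallel_x M'$, if they meet the same lines through $x$. Let $\mathcal I(x)$ be the inversive plane of order $n$ whose points are the lines through $x$ and a symbol $\infty_x$, and whose circles are - the $\parallel_x$-classes of lines missing $x$, where the class of $M$ is incident with exactly the lines through $x$ that meet $M$ (and not with $\infty_x$); - the sets $C_x(K,K')\cup\{\infty_x\}$ for distinct lines $K,K'$ through $x$, where $C_x(K,K')$ consists of $K$, $K'$ and all lines $K''$ through $x$ such that no line missing $x$ meets $K$, $K'$ and $K''$. A flock of $\mathcal I(x)$ with carriers $p\ne q$ is a set of mutually disjoint circles partitioning the set of all points other than $p,q$; it exists and is uniquely determined by $p,q$. For each line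 $L$ pick a point $x_L$ on $L$, arbitrarily. The special spread $\mathcal S_L$ of $L$ consists of $L$ and of all the lines in the $\parallel_{x_L}$-classes which are the circles of the flock of $\mathcal I(x_L)$ with carriers $L$ and $\infty_{x_L}$ (it does not depend on the choice of $x_L$). Put $\mathcal S^*_L=\mathcal S_L\setminus\{L\}$. Three distinct lines $L,M,N$ form a self-polar triangle if $\{L,M,N\}=\mathcal S_L\cap\mathcal S_M=\mathcal S_L\cap\mathcal S_N=\mathcal S_M\cap\mathcal S_N$. **Theorem.** Let $L,M,N$ be pairwise disjoint lines of $\mathcal U$. Then the following are equivalent. 1. $L,M,N$ form a self-polar triangle. 2. $L\parallel_z M$ for every point $z\in N$. 3. Every line meeting two of $L,M,N$ meets all of $L,M,N$. 4. $M\in\mathcal S^*_L$, and there exist distinct points $z_1,z_2\in N$ such that $L\parallel_{z_1}M$ and $L\parallel_{z_2}M$. -/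

import Mathlib

/-- A unital of order `n` on the point set `P`: a `2`-`(n ^ 3 + 1, n + 1, 1)` design, whose blocks
are called lines. -/
structure Unital (P : Type*) (n : ℕ) where
  lines : Set (Set P)
  card_points : Nat.card P = n ^ 3 + 1
  card_line : ∀ L ∈ lines, L.ncard = n + 1
  existsUnique_line : ∀ p q : P, p ≠ q → ∃! L : Set P, L ∈ lines ∧ p ∈ L ∧ q ∈ L

namespace Unital

variable {P : Type*} {n : ℕ}

/-- Four distinct lines form an O'Nan configuration if they intersect in six distinct points, that
is, any two of them meet and no three of them are concurrent. -/
def IsONan (U : Unital P n) (K : Fin 4 → Set P) : Prop :=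
  Function.Injective K ∧ (∀ i, K i ∈ U.lines) ∧
    (∀ i j, i ≠ j → (K i ∩ K j).Nonempty) ∧
    ∀ i j k, i ≠ j → i ≠ k → j ≠ k → K i ∩ K j ∩ K k = ∅

/-- Wilbrink's condition (I): there are no O'Nan configurations. -/
def ConditionI (U : Unital P n) : Prop :=
  ¬ ∃ K : Fin 4 → Set P, U.IsONan K

/-- Wilbrink's condition (II): if `L` is a line through `x`, `M` is a line missing `x` that meets
`L`, and `y` is a point of `L` other than `x`, then some line through `y` but not through `x` meets
all the lines through `x` that meet `M`. -/
def ConditionII (U : Unital P n) : Prop :=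
  ∀ (x : P), ∀ L ∈ U.lines, ∀ M ∈ U.lines, x ∈ L → x ∉ M → (L ∩ M).Nonempty →
    ∀ y ∈ L, y ≠ x → ∃ M' ∈ U.lines, y ∈ M' ∧ x ∉ M' ∧
      ∀ K ∈ U.lines, x ∈ K → (K ∩ M).Nonempty → (K ∩ M').Nonempty

/-- `x`-parallelism of two lines missing `x`: they meet the same lines through `x`. -/
def Parallel (U : Unital P n) (x : P) (M M' : Set P) : Prop :=
  (M ∈ U.lines ∧ x ∉ M) ∧ (M' ∈ U.lines ∧ x ∉ M') ∧
    ∀ K ∈ U.lines, x ∈ K → ((K ∩ M).Nonempty ↔ (K ∩ M').Nonempty)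

/-- The lines of the unital through `x`. -/
def Pencil (U : Unital P n) (x : P) : Type _ :=
  {K : Set P // K ∈ U.lines ∧ x ∈ K}

/-- The points of the inversive plane at `x`: the lines `K` through `x` (as `some K`) and one
further point `∞` (as `none`). -/
abbrev InvPoint (U : Unital P n) (x : P) : Type _ :=
  Option (U.Pencil x)

/-- The circle determined by a line `M` missing `x`, as a point set: the lines through `x` which
meet `M`. Two lines missing `x` determine the same circle if and only if they are `x`-parallel, so
these circles are the `x`-parallel classes. -/
def circleOf (U : Unital P n) (x : P) (M : Set P) : Set (U.InvPoint x) :=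
  some '' {K : U.Pencil x | (K.1 ∩ M).Nonempty}

/-- For lines `L`, `L'` through `x`: the set consisting of `L`, `L'` and of all the lines `L''`
through `x` such that no line missing `x` meets `L`, `L'` and `L''`. -/
def blockOf (U : Unital P n) (x : P) (L L' : U.Pencil x) : Set (U.Pencil x) :=
  {L, L'} ∪ {L'' | ¬ ∃ M ∈ U.lines, x ∉ M ∧
    (M ∩ L.1).Nonempty ∧ (M ∩ L'.1).Nonempty ∧ (M ∩ L''.1).Nonempty}

/-- The circles (as point sets) of the inversive plane at `x`: those given by the lines missing
`x`, and those of the form `blockOf x L L' ∪ {∞}` with `L ≠ L'`. -/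
def circles (U : Unital P n) (x : P) : Set (Set (U.InvPoint x)) :=
  {C | ∃ M ∈ U.lines, x ∉ M ∧ C = U.circleOf x M} ∪
    {C | ∃ L L' : U.Pencil x, L ≠ L' ∧ C = insert none (some '' U.blockOf x L L')}

/-- A flock with carriers `p`, `q` of the inversive plane at `x`: a set of mutually disjoint circles
that partition the set of all points other than `p` and `q`. -/
structure IsFlock (U : Unital P n) (x : P) (p q : U.InvPoint x)
    (F : Set (Set (U.InvPoint x))) : Prop where
  carriers_ne : p ≠ q
  subset_circles : F ⊆ U.circles x
  disjoint : ∀ C ∈ F, ∀ D ∈ F, C ≠ D → Disjoint C D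
  sUnion_eq : ⋃₀ F = {p, q}ᶜ

/-- The special spread of the line `L`, constructed at the point `x` of `L`: the line `L`, together
with all the lines in those `x`-parallel classes that are the circles of the flock with carriers
`L` and `∞` of the inversive plane at `x`. -/
def specialSpread (U : Unital P n) (x : P) (L : Set P) : Set (Set P) :=
  {L} ∪ {M | M ∈ U.lines ∧ x ∉ M ∧ ∃ (hL : L ∈ U.lines ∧ x ∈ L) (F : Set (Set (U.InvPoint x))),
    U.IsFlock x (some ⟨L, hL⟩) none F ∧ U.circleOf x M ∈ F}

/-- `L`, `M`, `N` form a self-polar triangle: they are three distinct lines, and `{L, M, N}` is the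
intersection of any two of their special spreads. Here the special spread of a line `K` is
constructed at the chosen point `pick K` of `K`. -/
def IsSelfPolarTriangle (U : Unital P n) (pick : Set P → P) (L M N : Set P) : Prop :=
  (L ∈ U.lines ∧ M ∈ U.lines ∧ N ∈ U.lines) ∧ (L ≠ M ∧ L ≠ N ∧ M ≠ N) ∧
    {L, M, N} = U.specialSpread (pick L) L ∩ U.specialSpread (pick M) M ∧
    {L, M, N} = U.specialSpread (pick L) L ∩ U.specialSpread (pick N) N ∧
    {L, M, N} = U.specialSpread (pick M) M ∩ U.specialSpread (pick N) N

end Unital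

/-!
Under Wilbrink's conditions the circles at every point form an inversive plane of even order. In
such a plane each point `p` off a circle `C` has a unique inverse point `q`: all circles through `p`
and `q` are tangent to `C`. The flock with carriers `p` and `q` consists of the circles with respect
to which `p` and `q` are inverse to each other.

Read in the unital, with `q = ∞`, this says that a line `M` lies in the special spread of a disjoint
line `L` if and only if `L` and `M` are parallel with respect to two distinct points, in which case
they are called conjugate. Each point off `L` lies on a unique conjugate of `L`. The points with
respect to which two conjugate lines are parallel are the points of a line conjugate to both, and by
counting this is the only line conjugate to both. Hence self-polar triangles are the triples of
mutually conjugate lines, and each of the other conditions says that `N` is the line of points with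
respect to which `L` and `M` are parallel.
-/

section Counting

variable {α ι : Type*} [Finite α] [Finite ι] {S : Set α} {T : Set ι} {C : ι → Set α}

theorem ncard_eq_finsum_of_existsUnique (h : ∀ a ∈ S, ∃! i, i ∈ T ∧ a ∈ C i) :
    S.ncard = ∑ᶠ i ∈ T, (S ∩ C i).ncard := by
  have hS : S = ⋃ i ∈ T, S ∩ C i := by
    ext a
    simpa using fun ha => (h a ha).exists
  conv_lhs => rw [hS]
  refine Set.Finite.ncard_biUnion T.toFinite (fun i _ => Set.toFinite _) fun i hi j hj hij => ?_
  exact Set.disjoint_left.2 fun a ha ha' => hij ((h a ha.1).unique ⟨hi, ha.2⟩ ⟨hj, ha'.2⟩)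

theorem ncard_eq_mul_of_existsUnique {k : ℕ} (h : ∀ a ∈ S, ∃! i, i ∈ T ∧ a ∈ C i)
    (hk : ∀ i ∈ T, (S ∩ C i).ncard = k) : S.ncard = T.ncard * k := by
  rw [ncard_eq_finsum_of_existsUnique h, finsum_mem_congr rfl hk,
    finsum_mem_eq_finite_toFinset_sum _ T.toFinite, Finset.sum_const, smul_eq_mul,
    Set.ncard_eq_toFinset_card T]

theorem odd_ncard_of_existsUnique (h : ∀ a ∈ S, ∃! i, i ∈ T ∧ a ∈ C i) (hS : Odd S.ncard) :
    Odd {i ∈ T | Odd (S ∩ C i).ncard}.ncard := by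
  classical
  rw [ncard_eq_finsum_of_existsUnique h, finsum_mem_eq_finite_toFinset_sum _ T.toFinite,
    Finset.odd_sum_iff_odd_card_odd, ← Set.ncard_coe_finset] at hS
  simpa using hS

theorem exists_odd_of_existsUnique (h : ∀ a ∈ S, ∃! i, i ∈ T ∧ a ∈ C i) (hS : Odd S.ncard) :
    ∃ i ∈ T, Odd (S ∩ C i).ncard :=
  (Set.ncard_pos).1 (odd_ncard_of_existsUnique h hS).pos

end Counting

/-- The family `𝒞` of circles makes `X` an inversive plane (a `3`-`(n ^ 2 + 1, n + 1, 1)` design) of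
order `n`. -/
structure IsInversivePlane {X : Type*} (n : ℕ) (𝒞 : Set (Set X)) : Prop where
  two_le : 2 ≤ n
  card_points : Nat.card X = n ^ 2 + 1
  card_circle : ∀ C ∈ 𝒞, C.ncard = n + 1
  existsUnique_circle : ∀ a b c : X, a ≠ b → a ≠ c → b ≠ c → ∃! C, C ∈ 𝒞 ∧ a ∈ C ∧ b ∈ C ∧ c ∈ C

namespace IsInversivePlane

variable {X : Type*} {n : ℕ} {𝒞 : Set (Set X)} {C D E : Set X} {p q r s : X}

/-- The bundle of circles with carriers `p` and `q`: the circles through `p` and `q`. -/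
def bundle (𝒞 : Set (Set X)) (p q : X) : Set (Set X) :=
  {D ∈ 𝒞 | p ∈ D ∧ q ∈ D}

/-- Tangency of circles: they have exactly one common point. -/
def IsTangent (C D : Set X) : Prop :=
  (C ∩ D).ncard = 1

/-- The points `p` and `q` are inverse to each other with respect to the circle `C`: they are
distinct points off `C`, and every circle through `p` and `q` is tangent to `C`. (In planes of even
order tangency plays the role of orthogonality; in the affine plane derived at `p`, the point `q` is
the nucleus of the oval `C`.) -/
structure AreInverse (𝒞 : Set (Set X)) (C : Set X) (p q : X) : Prop where
  ne : p ≠ q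
  left_notMem : p ∉ C
  right_notMem : q ∉ C
  isTangent : ∀ D ∈ bundle 𝒞 p q, IsTangent C D

/-- A flock with carriers `p` and `q`: mutually disjoint circles that partition the set of all
points other than `p` and `q`. -/
structure IsFlock (𝒞 : Set (Set X)) (p q : X) (F : Set (Set X)) : Prop where
  carriers_ne : p ≠ q
  subset_circles : F ⊆ 𝒞
  disjoint : ∀ C ∈ F, ∀ D ∈ F, C ≠ D → Disjoint C D
  sUnion_eq : ⋃₀ F = {p, q}ᶜ

theorem bundle_comm (𝒞 : Set (Set X)) (p q : X) : bundle 𝒞 p q = bundle 𝒞 q p := by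
  simp only [bundle, and_comm]

theorem IsTangent.symm (h : IsTangent C D) : IsTangent D C := by
  rwa [IsTangent, Set.inter_comm]

theorem IsTangent.inter_eq (h : IsTangent C D) (hpC : p ∈ C) (hpD : p ∈ D) : C ∩ D = {p} := by
  obtain ⟨a, ha⟩ := Set.ncard_eq_one.1 h
  obtain rfl : p = a := ha.le ⟨hpC, hpD⟩
  exact ha

theorem IsTangent.eq_of_mem (h : IsTangent C D) (hpC : p ∈ C) (hpD : p ∈ D) (hqC : q ∈ C)
    (hqD : q ∈ D) : p = q :=
  (h.inter_eq hqC hqD).le ⟨hpC, hpD⟩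

theorem IsTangent.nonempty (h : IsTangent C D) : (C ∩ D).Nonempty :=
  Set.nonempty_of_ncard_ne_zero (h.trans_ne one_ne_zero)

theorem AreInverse.symm (h : AreInverse 𝒞 C p q) : AreInverse 𝒞 C q p :=
  ⟨h.ne.symm, h.right_notMem, h.left_notMem, bundle_comm 𝒞 q p ▸ h.isTangent⟩

theorem finite (h : IsInversivePlane n 𝒞) : Finite X :=
  Nat.finite_of_card_ne_zero (by rw [h.card_points]; omega)

theorem nonempty (h : IsInversivePlane n 𝒞) (hC : C ∈ 𝒞) : C.Nonempty :=
  Set.nonempty_of_ncard_ne_zero (by rw [h.card_circle C hC]; exact n.succ_ne_zero)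

theorem existsUnique_mem_bundle (h : IsInversivePlane n 𝒞) (hpq : p ≠ q) (hpr : p ≠ r)
    (hqr : q ≠ r) : ∃! D, D ∈ bundle 𝒞 p q ∧ r ∈ D := by
  simpa only [bundle, Set.mem_ofPred_eq, and_assoc] using h.existsUnique_circle p q r hpq hpr hqr

theorem existsUnique_mem_bundle_of_notMem (h : IsInversivePlane n 𝒞) (hpq : p ≠ q) (hp : p ∉ C)
    (hq : q ∉ C) : ∀ a ∈ C, ∃! D, D ∈ bundle 𝒞 p q ∧ a ∈ D := fun _ ha =>
  h.existsUnique_mem_bundle hpq (fun e => hp (e ▸ ha)) (fun e => hq (e ▸ ha))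

theorem eq_of_mem_bundle (h : IsInversivePlane n 𝒞) (hC : C ∈ bundle 𝒞 p q)
    (hD : D ∈ bundle 𝒞 p q) (hpq : p ≠ q) (hpr : p ≠ r) (hqr : q ≠ r) (hrC : r ∈ C) (hrD : r ∈ D) :
    C = D :=
  (h.existsUnique_mem_bundle hpq hpr hqr).unique ⟨hC, hrC⟩ ⟨hD, hrD⟩

theorem ncard_sdiff_singleton (h : IsInversivePlane n 𝒞) (hC : C ∈ 𝒞) (hp : p ∈ C) :
    (C \ {p}).ncard = n := by
  rw [Set.ncard_sdiff_singleton_of_mem hp, h.card_circle C hC, Nat.add_sub_cancel]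

theorem ncard_sdiff_pair (h : IsInversivePlane n 𝒞) (hpq : p ≠ q) (hC : C ∈ bundle 𝒞 p q) :
    (C \ {p, q}).ncard = n - 1 := by
  rw [Set.ncard_sdiff (Set.pair_subset hC.2.1 hC.2.2), Set.ncard_pair hpq, h.card_circle C hC.1]
  omega

theorem ncard_compl_pair (h : IsInversivePlane n 𝒞) (hpq : p ≠ q) :
    ({p, q}ᶜ : Set X).ncard = (n + 1) * (n - 1) := by
  have := h.finite
  rw [Set.ncard_compl, h.card_points, Set.ncard_pair hpq, ← Nat.sq_sub_sq, one_pow]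
  omega

theorem ncard_inter_le (h : IsInversivePlane n 𝒞) (hC : C ∈ 𝒞) (hD : D ∈ 𝒞) (hCD : C ≠ D) :
    (C ∩ D).ncard ≤ 2 := by
  have := h.finite
  by_contra! hlt
  obtain ⟨a, b, c, ha, hb, hc, hab, hac, hbc⟩ := (Set.two_lt_ncard_iff).1 hlt
  exact hCD (h.eq_of_mem_bundle ⟨hC, ha.1, hb.1⟩ ⟨hD, ha.2, hb.2⟩ hab hac hbc hc.1 hc.2)

theorem isTangent_of_odd (h : IsInversivePlane n 𝒞) (hC : C ∈ 𝒞) (hD : D ∈ 𝒞) (hCD : C ≠ D)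
    (hodd : Odd (C ∩ D).ncard) : IsTangent C D := by
  have hle := h.ncard_inter_le hC hD hCD
  obtain ⟨k, hk⟩ := hodd
  rw [IsTangent]
  omega

theorem ncard_bundle (h : IsInversivePlane n 𝒞) (hpq : p ≠ q) : (bundle 𝒞 p q).ncard = n + 1 := by
  have := h.finite
  have hcount := ncard_eq_mul_of_existsUnique (S := {p, q}ᶜ) (T := bundle 𝒞 p q) (C := id)
    (h.existsUnique_mem_bundle_of_notMem hpq (by simp) (by simp))
    (fun C hC => by
      rw [Set.inter_comm, id, ← Set.sdiff_eq, h.ncard_sdiff_pair hpq hC])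
  rw [h.ncard_compl_pair hpq] at hcount
  exact (Nat.eq_of_mul_eq_mul_right (by have := h.two_le; omega) hcount).symm

theorem exists_ne_mem_bundle (h : IsInversivePlane n 𝒞) (hpq : p ≠ q) (D : Set X) :
    ∃ E ∈ bundle 𝒞 p q, E ≠ D :=
  Set.exists_ne_of_one_lt_ncard (by rw [h.ncard_bundle hpq]; have := h.two_le; omega) D

theorem existsUnique_isTangent (h : IsInversivePlane n 𝒞) (hC : C ∈ 𝒞) (hp : p ∈ C) (hq : q ∉ C) :
    ∃! D, D ∈ bundle 𝒞 p q ∧ IsTangent C D := by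
  have := h.finite
  have hpq : p ≠ q := fun e => hq (e ▸ hp)
  let T := {D ∈ bundle 𝒞 p q | ¬IsTangent C D}
  have hmeet : ∀ D ∈ bundle 𝒞 p q, ∀ a ∈ C \ {p}, a ∈ D → ¬IsTangent C D :=
    fun D hD a ha haD hCD => ha.2 (hCD.eq_of_mem ha.1 haD hp hD.2.1)
  have hT : T.ncard = n := by
    have hcount := ncard_eq_mul_of_existsUnique (S := C \ {p}) (T := T) (C := id) (k := 1)
      (fun a ha => by
        obtain ⟨D, ⟨hD, haD⟩, huniq⟩ := h.existsUnique_mem_bundle hpq (Ne.symm ha.2)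
          (fun e => hq (e ▸ ha.1))
        exact ⟨D, ⟨⟨hD, hmeet D hD a ha haD⟩, haD⟩, fun E hE => huniq E ⟨hE.1.1, hE.2⟩⟩)
      (fun D hD => by
        have hle := h.ncard_inter_le hC hD.1.1 (fun e => hq (e ▸ hD.1.2.2))
        have hpCD : p ∈ C ∩ D := ⟨hp, hD.1.2.1⟩
        have hpos := (Set.ncard_pos).2 ⟨p, hpCD⟩
        have hne : (C ∩ D).ncard ≠ 1 := hD.2
        rw [id, ← Set.inter_sdiff_right_comm, Set.ncard_sdiff_singleton_of_mem hpCD]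
        omega)
    rw [h.ncard_sdiff_singleton hC hp, mul_one] at hcount
    exact hcount.symm
  have hone : (bundle 𝒞 p q \ T).ncard = 1 := by
    rw [Set.ncard_sdiff fun _ hD => hD.1, hT, h.ncard_bundle hpq, Nat.add_sub_cancel_left]
  obtain ⟨D, hD⟩ := Set.ncard_eq_one.1 hone
  have hiff : ∀ E, (E ∈ bundle 𝒞 p q ∧ IsTangent C E) ↔ E = D := fun E => by
    rw [← Set.mem_singleton_iff, ← hD]
    simp only [T, Set.mem_sdiff, Set.mem_ofPred_eq]
    tauto
  exact ⟨D, (hiff D).2 rfl, fun E => (hiff E).1⟩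

theorem odd_ncard_isTangent (h : IsInversivePlane n 𝒞) (he : Even n) (hC : C ∈ 𝒞) (hpq : p ≠ q)
    (hp : p ∉ C) (hq : q ∉ C) : Odd {D ∈ bundle 𝒞 p q | IsTangent C D}.ncard := by
  have := h.finite
  convert odd_ncard_of_existsUnique (C := id) (h.existsUnique_mem_bundle_of_notMem hpq hp hq)
    (by rw [h.card_circle C hC]; exact he.add_one) using 4 with D
  refine and_congr_right fun hD => ⟨fun hCD : (C ∩ D).ncard = 1 => hCD ▸ odd_one, ?_⟩
  exact h.isTangent_of_odd hC hD.1 fun e => hp (e ▸ hD.2.1)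

theorem exists_isTangent (h : IsInversivePlane n 𝒞) (he : Even n) (hC : C ∈ 𝒞) (hpq : p ≠ q)
    (hp : p ∉ C) : ∃ D ∈ bundle 𝒞 p q, IsTangent C D := by
  have := h.finite
  by_cases hq : q ∈ C
  · rw [bundle_comm]
    exact (h.existsUnique_isTangent hC hq hp).exists
  · exact (Set.ncard_pos).1 (h.odd_ncard_isTangent he hC hpq hp hq).pos

theorem ncard_isTangent_of_notMem (h : IsInversivePlane n 𝒞) (hC : C ∈ 𝒞) (hp : p ∉ C) :
    {D ∈ 𝒞 | p ∈ D ∧ IsTangent C D}.ncard = n + 1 := by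
  have := h.finite
  have hcount := ncard_eq_mul_of_existsUnique (S := C)
    (T := {D ∈ 𝒞 | p ∈ D ∧ IsTangent C D}) (C := id)
    (fun a ha => (existsUnique_congr fun D => by simp only [bundle, id, Set.mem_ofPred_eq]; tauto).1
      (h.existsUnique_isTangent hC ha hp))
    (fun D hD => hD.2.2)
  rw [h.card_circle C hC, mul_one] at hcount
  exact hcount.symm

theorem ncard_inter_le_one_of_isTangent (h : IsInversivePlane n 𝒞) (he : Even n) (hC : C ∈ 𝒞)
    {D' : Set X} (hne : D ≠ D') (hpq : p ≠ q) (hp : p ∉ C) (hq : q ∉ C) (hD : D ∈ bundle 𝒞 p q)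
    (hD' : D' ∈ bundle 𝒞 p q) (hCD : IsTangent C D) (hCD' : IsTangent C D')
    (hE : E ∈ bundle 𝒞 p q) : (C ∩ E).ncard ≤ 1 := by
  have := h.finite
  by_contra! hlt
  -- The number of tangents to `C` in the bundle of `p` and `q` is odd, hence at least `3`. Since
  -- `E` is not a tangent, its other `n - 1` points lie on further tangents through `p`, pairwise
  -- distinct; but only `n + 1` tangents pass through `p`.
  have htangent : ∀ v ∈ E \ {p, q}, ∃ T, T ∈ bundle 𝒞 p v ∧ IsTangent C T := fun v hv =>
    h.exists_isTangent he hC (fun e => hv.2 (.inl e.symm)) hp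
  choose! f hf hfC using htangent
  have hinter : ∀ v ∈ E \ {p, q}, ∀ w ∈ E, p ≠ w → w ∈ f v → v = w := by
    intro v hv w hw hpw hwv
    by_contra hvw
    have heq : f v = E := h.eq_of_mem_bundle (hf v hv) ⟨hE.1, hE.2.1, hv.1⟩
      (fun e => hv.2 (.inl e.symm)) hpw hvw hwv hw
    exact hlt.ne' (heq ▸ hfC v hv)
  have hinj : Set.InjOn f (E \ {p, q}) := fun v hv w hw hvw =>
    hinter v hv w hw.1 (fun e => hw.2 (.inl e.symm)) (hvw ▸ (hf w hw).2.2)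
  set T := {D ∈ bundle 𝒞 p q | IsTangent C D}
  have hdisj : Disjoint T (f '' (E \ {p, q})) := by
    rw [Set.disjoint_right]
    rintro _ ⟨v, hv, rfl⟩ hT
    exact hv.2 (.inr (hinter v hv q hE.2.2 hpq hT.1.2.2))
  have hle : (T ∪ f '' (E \ {p, q})).ncard ≤ {D ∈ 𝒞 | p ∈ D ∧ IsTangent C D}.ncard := by
    refine Set.ncard_le_ncard (Set.union_subset (fun D hD => ⟨hD.1.1, hD.1.2.1, hD.2⟩) ?_)
    rintro _ ⟨v, hv, rfl⟩
    exact ⟨(hf v hv).1, (hf v hv).2.1, hfC v hv⟩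
  rw [Set.ncard_union_eq hdisj, hinj.ncard_image, h.ncard_sdiff_pair hpq hE,
    h.ncard_isTangent_of_notMem hC hp] at hle
  have htwo : 1 < T.ncard := (Set.one_lt_ncard_iff).2 ⟨D, D', ⟨hD, hCD⟩, ⟨hD', hCD'⟩, hne⟩
  obtain ⟨k, hk⟩ : Odd T.ncard := h.odd_ncard_isTangent he hC hpq hp hq
  omega

theorem areInverse_of_isTangent (h : IsInversivePlane n 𝒞) (he : Even n) (hC : C ∈ 𝒞)
    {D' : Set X} (hne : D ≠ D') (hpq : p ≠ q) (hp : p ∉ C) (hq : q ∉ C) (hD : D ∈ bundle 𝒞 p q)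
    (hD' : D' ∈ bundle 𝒞 p q) (hCD : IsTangent C D) (hCD' : IsTangent C D') :
    AreInverse 𝒞 C p q := by
  have := h.finite
  have hle : ∀ E ∈ bundle 𝒞 p q, (C ∩ E).ncard ≤ 1 := fun E =>
    h.ncard_inter_le_one_of_isTangent he hC hne hpq hp hq hD hD' hCD hCD'
  have hcircle : ∀ a ∈ C, ∃ E, E ∈ bundle 𝒞 p q ∧ a ∈ E := fun a ha =>
    (h.existsUnique_mem_bundle_of_notMem hpq hp hq a ha).exists
  choose! f hf hmem using hcircle
  have hinj : Set.InjOn f C := fun a ha b hb hab =>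
    (Set.ncard_le_one_iff).1 (hle (f b) (hf b hb)) ⟨ha, hab ▸ hmem a ha⟩ ⟨hb, hmem b hb⟩
  have himage : f '' C = bundle 𝒞 p q :=
    Set.eq_of_subset_of_ncard_le (Set.image_subset_iff.2 hf)
      (by rw [hinj.ncard_image, h.card_circle C hC, h.ncard_bundle hpq])
  refine ⟨hpq, hp, hq, fun E hE => (hle E hE).antisymm ?_⟩
  obtain ⟨a, ha, rfl⟩ := himage.ge hE
  exact (Set.ncard_pos).2 ⟨a, ha, hmem a ha⟩

theorem exists_areInverse (h : IsInversivePlane n 𝒞) (he : Even n) (hC : C ∈ 𝒞) (hp : p ∉ C) :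
    ∃ q, AreInverse 𝒞 C p q := by
  have := h.finite
  by_contra! hno
  -- If `p` has no inverse point, the `n + 1` tangents to `C` through `p` partition the `n ^ 2`
  -- other points into sets of size `n`.
  have hcount := ncard_eq_mul_of_existsUnique (S := {p}ᶜ)
    (T := {D ∈ 𝒞 | p ∈ D ∧ IsTangent C D}) (C := id) (k := n)
    (fun q hq => by
      have hpq : p ≠ q := Ne.symm hq
      obtain ⟨D, hD, hCD⟩ := h.exists_isTangent he hC hpq hp
      refine ⟨D, ⟨⟨hD.1, hD.2.1, hCD⟩, hD.2.2⟩, fun E ⟨⟨hE, hpE, hCE⟩, hqE⟩ => ?_⟩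
      by_contra hne
      by_cases hqC : q ∈ C
      · rw [bundle_comm] at hD
        exact hne ((h.existsUnique_isTangent hC hqC hp).unique ⟨⟨hE, hqE, hpE⟩, hCE⟩ ⟨hD, hCD⟩)
      · exact hno q
          (h.areInverse_of_isTangent he hC hne hpq hp hqC ⟨hE, hpE, hqE⟩ hD hCE hCD))
    (fun D hD => by
      rw [Set.inter_comm, id, ← Set.sdiff_eq, h.ncard_sdiff_singleton hD.1 hD.2.1])
  rw [h.ncard_isTangent_of_notMem hC hp, Set.ncard_compl, h.card_points, Set.ncard_singleton,
    Nat.add_sub_cancel] at hcount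
  nlinarith [h.two_le]

theorem AreInverse.unique (h : IsInversivePlane n 𝒞) (hC : C ∈ 𝒞) (hq : AreInverse 𝒞 C p q)
    (hr : AreInverse 𝒞 C p r) : q = r := by
  by_contra hqr
  obtain ⟨D, ⟨hD, hrD⟩, -⟩ := h.existsUnique_mem_bundle hq.ne hr.ne hqr
  obtain ⟨E, hE, hED⟩ := h.exists_ne_mem_bundle hq.ne D
  obtain ⟨u, huC, huE⟩ := (hq.isTangent E hE).nonempty
  have hpu : p ≠ u := fun e => hq.left_notMem (e ▸ huC)
  have hru : r ≠ u := fun e => hr.right_notMem (e ▸ huC)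
  obtain ⟨G, ⟨hG, huG⟩, -⟩ := h.existsUnique_mem_bundle hr.ne hpu hru
  have hEG : E = G := (h.existsUnique_isTangent hC huC hq.left_notMem).unique
    ⟨⟨hE.1, huE, hE.2.1⟩, hq.isTangent E hE⟩ ⟨⟨hG.1, huG, hG.2.1⟩, hr.isTangent G hG⟩
  exact hED (h.eq_of_mem_bundle hE hD hq.ne hr.ne hqr (hEG ▸ hG.2.2) hrD)

theorem exists_isTangent_areInverse (h : IsInversivePlane n 𝒞) (he : Even n) (hpq : p ≠ q)
    (hpr : p ≠ r) (hqr : q ≠ r) (hD : D ∈ bundle 𝒞 p q) (hrD : r ∈ D) :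
    ∃ C ∈ 𝒞, r ∈ C ∧ IsTangent D C ∧ AreInverse 𝒞 C p q := by
  have := h.finite
  obtain ⟨E, hE, hED⟩ := h.exists_ne_mem_bundle hpq D
  obtain ⟨C, ⟨hC, hrC, hDC⟩, hodd⟩ := exists_odd_of_existsUnique (S := E \ {p, q})
    (T := {C ∈ 𝒞 | r ∈ C ∧ IsTangent D C}) (C := id)
    (fun s hs => by
      have hsD : s ∉ D := fun hsD => hED (h.eq_of_mem_bundle hE hD hpq
        (fun e => hs.2 (.inl e.symm)) (fun e => hs.2 (.inr e.symm)) hs.1 hsD)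
      refine (existsUnique_congr fun C => ?_).1 (h.existsUnique_isTangent hD.1 hrD hsD)
      simp only [bundle, id, Set.mem_ofPred_eq]
      tauto)
    (by
      rw [h.ncard_sdiff_pair hpq hE]
      exact Nat.Even.sub_odd (by have := h.two_le; omega) he odd_one)
  have hpC : p ∉ C := fun hpC => hpr (hDC.eq_of_mem hD.2.1 hpC hrD hrC)
  have hqC : q ∉ C := fun hqC => hqr (hDC.eq_of_mem hD.2.2 hqC hrD hrC)
  have hinter : E \ {p, q} ∩ id C = C ∩ E := by
    rw [id, Set.inter_comm, ← Set.inter_sdiff_assoc, sdiff_eq_left, Set.disjoint_right]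
    rintro a (rfl | rfl) ha
    exacts [hpC ha.1, hqC ha.1]
  have hCE := h.isTangent_of_odd hC hE.1 (fun e => hpC (e ▸ hE.2.1)) (hinter ▸ hodd)
  exact ⟨C, hC, hrC, hDC,
    h.areInverse_of_isTangent he hC hED hpq hpC hqC hE hD hCE hDC.symm⟩

theorem exists_areInverse_of_mem (h : IsInversivePlane n 𝒞) (he : Even n) (hpq : p ≠ q)
    (hpr : p ≠ r) (hqr : q ≠ r) : ∃ C ∈ 𝒞, r ∈ C ∧ AreInverse 𝒞 C p q := by
  obtain ⟨D, ⟨hD, hrD⟩, -⟩ := h.existsUnique_mem_bundle hpq hpr hqr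
  obtain ⟨C, hC, hrC, -, hinv⟩ := h.exists_isTangent_areInverse he hpq hpr hqr hD hrD
  exact ⟨C, hC, hrC, hinv⟩

theorem ncard_isTangent_of_mem (h : IsInversivePlane n 𝒞) (hD : D ∈ 𝒞) (hr : r ∈ D) :
    {C ∈ 𝒞 | r ∈ C ∧ IsTangent D C}.ncard = n - 1 := by
  have := h.finite
  have hcount := ncard_eq_mul_of_existsUnique (S := Dᶜ)
    (T := {C ∈ 𝒞 | r ∈ C ∧ IsTangent D C}) (C := id) (k := n)
    (fun s hs => (existsUnique_congr fun C => by
      simp only [bundle, id, Set.mem_ofPred_eq]; tauto).1 (h.existsUnique_isTangent hD hr hs))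
    (fun C hC => by
      have hsdiff : C \ D = C \ {r} := by
        rw [← hC.2.2.inter_eq hr hC.2.1, Set.sdiff_inter_self_eq_sdiff]
      rw [Set.inter_comm, id, ← Set.sdiff_eq, hsdiff, h.ncard_sdiff_singleton hC.1 hC.2.1])
  have hpoints : n ^ 2 + 1 - (n + 1) = (n - 1) * n := by rw [sq, Nat.sub_mul]; omega
  rw [Set.ncard_compl, h.card_points, h.card_circle D hD, hpoints] at hcount
  exact (Nat.eq_of_mul_eq_mul_right (by have := h.two_le; omega) hcount).symm

theorem AreInverse.eq_of_mem (h : IsInversivePlane n 𝒞) (he : Even n) {C' : Set X} (hC : C ∈ 𝒞)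
    (hC' : C' ∈ 𝒞) (hinv : AreInverse 𝒞 C p q) (hinv' : AreInverse 𝒞 C' p q) (hr : r ∈ C)
    (hr' : r ∈ C') : C = C' := by
  have := h.finite
  have hpr : p ≠ r := fun e => hinv.left_notMem (e ▸ hr)
  have hqr : q ≠ r := fun e => hinv.right_notMem (e ▸ hr)
  obtain ⟨D, ⟨hD, hrD⟩, -⟩ := h.existsUnique_mem_bundle hinv.ne hpr hqr
  have hcircle : ∀ s ∈ D \ {p, r}, ∃ C, C ∈ {C ∈ 𝒞 | r ∈ C ∧ IsTangent D C} ∧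
      AreInverse 𝒞 C p s := fun s hs => by
    obtain ⟨C, hC, hrC, hDC, hs⟩ := h.exists_isTangent_areInverse he (fun e => hs.2 (.inl e.symm))
      hpr (fun e => hs.2 (.inr e)) ⟨hD.1, hD.2.1, hs.1⟩ hrD
    exact ⟨C, ⟨hC, hrC, hDC⟩, hs⟩
  choose! f hf hfinv using hcircle
  have hinj : Set.InjOn f (D \ {p, r}) := fun s hs t ht hst =>
    AreInverse.unique h (hf s hs).1 (hfinv s hs) (hst ▸ hfinv t ht)
  have himage : f '' (D \ {p, r}) = {C ∈ 𝒞 | r ∈ C ∧ IsTangent D C} :=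
    Set.eq_of_subset_of_ncard_le (Set.image_subset_iff.2 hf) (by
      rw [hinj.ncard_image, h.ncard_sdiff_pair hpr ⟨hD.1, hD.2.1, hrD⟩,
        h.ncard_isTangent_of_mem hD.1 hrD])
  have hall : ∀ C ∈ 𝒞, r ∈ C → AreInverse 𝒞 C p q → C = f q := by
    intro C hC hr hinv
    obtain ⟨s, hs, rfl⟩ := himage.ge ⟨hC, hr, (hinv.isTangent D hD).symm⟩
    rw [AreInverse.unique h hC hinv (hfinv s hs)]
  rw [hall C hC hr hinv, hall C' hC' hr' hinv']

section Flock

variable {F : Set (Set X)}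

theorem IsFlock.subset_compl (hF : IsFlock 𝒞 p q F) (hC : C ∈ F) : C ⊆ {p, q}ᶜ :=
  hF.sUnion_eq ▸ Set.subset_sUnion_of_mem hC

theorem IsFlock.existsUnique_mem (hF : IsFlock 𝒞 p q F) {a : X} (ha : a ∈ ({p, q}ᶜ : Set X)) :
    ∃! C, C ∈ F ∧ a ∈ C := by
  obtain ⟨C, hC, haC⟩ := hF.sUnion_eq.symm ▸ ha
  refine ⟨C, ⟨hC, haC⟩, fun D ⟨hD, haD⟩ => ?_⟩
  by_contra hne
  exact Set.disjoint_left.1 (hF.disjoint D hD C hC hne) haD haC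

theorem ncard_flock (h : IsInversivePlane n 𝒞) (hF : IsFlock 𝒞 p q F) : F.ncard = n - 1 := by
  have := h.finite
  have hcount := ncard_eq_mul_of_existsUnique (T := F) (C := id) (k := n + 1)
    (fun a => hF.existsUnique_mem) (fun C hC => by
      rw [id, Set.inter_eq_right.2 (hF.subset_compl hC), h.card_circle C (hF.subset_circles hC)])
  rw [h.ncard_compl_pair hF.carriers_ne, mul_comm] at hcount
  exact (Nat.eq_of_mul_eq_mul_right n.succ_pos hcount).symm

theorem exists_odd_inter_flock (h : IsInversivePlane n 𝒞) (he : Even n) (hF : IsFlock 𝒞 p q F)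
    (hE : E ∈ 𝒞) (hp : p ∉ E) (hq : q ∉ E) : ∃ C ∈ F, Odd (C ∩ E).ncard := by
  have := h.finite
  simp only [Set.inter_comm _ E]
  refine exists_odd_of_existsUnique (C := id) (fun a ha => hF.existsUnique_mem ?_)
    (h.card_circle E hE ▸ he.add_one)
  rintro (rfl | rfl)
  exacts [hp ha, hq ha]

theorem areInverse_of_odd (h : IsInversivePlane n 𝒞) (he : Even n) (hC : C ∈ 𝒞) {E' : Set X}
    (hrs : r ≠ s) (hE : E ∈ bundle 𝒞 r s) (hE' : E' ∈ bundle 𝒞 r s) (hne : E ≠ E')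
    (hodd : Odd (C ∩ E).ncard) (hodd' : Odd (C ∩ E').ncard) : AreInverse 𝒞 C r s := by
  have hnot : ¬(r ∈ C ∧ s ∈ C) := by
    rintro ⟨hrC, hsC⟩
    have heq : ∀ G ∈ bundle 𝒞 r s, Odd (C ∩ G).ncard → C = G := fun G hG hodd => by
      by_contra hCG
      exact hrs ((h.isTangent_of_odd hC hG.1 hCG hodd).eq_of_mem hrC hG.2.1 hsC hG.2.2)
    exact hne ((heq E hE hodd).symm.trans (heq E' hE' hodd'))
  have htangent : ∀ G ∈ bundle 𝒞 r s, Odd (C ∩ G).ncard → IsTangent C G := fun G hG =>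
    h.isTangent_of_odd hC hG.1 fun e => hnot (e ▸ hG.2)
  have hCE := htangent E hE hodd
  have hCE' := htangent E' hE' hodd'
  have hrC : r ∉ C := fun hrC => hne
    ((h.existsUnique_isTangent hC hrC fun hsC => hnot ⟨hrC, hsC⟩).unique ⟨hE, hCE⟩ ⟨hE', hCE'⟩)
  have hsC : s ∉ C := fun hsC => hne
    ((h.existsUnique_isTangent hC hsC hrC).unique ⟨bundle_comm 𝒞 r s ▸ hE, hCE⟩
      ⟨bundle_comm 𝒞 r s ▸ hE', hCE'⟩)
  exact h.areInverse_of_isTangent he hC hne hrs hrC hsC hE hE' hCE hCE'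

theorem exists_mem_flock_areInverse (h : IsInversivePlane n 𝒞) (he : Even n)
    (hF : IsFlock 𝒞 p q F) (hD : D ∈ bundle 𝒞 p q) (hr : r ∈ D \ {p, q}) (hs : s ∈ D \ {p, q})
    (hrs : r ≠ s) : ∃ C ∈ F, AreInverse 𝒞 C r s := by
  have := h.finite
  have hoff : ∀ a ∈ ({p, q} : Set X), ∀ E ∈ bundle 𝒞 r s \ {D}, a ∉ E := fun a ha E hE haE =>
    hE.2 (h.eq_of_mem_bundle hE.1 ⟨hD.1, hr.1, hs.1⟩ hrs (fun e => hr.2 (e ▸ ha))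
      (fun e => hs.2 (e ▸ ha)) haE (Set.pair_subset hD.2.1 hD.2.2 ha))
  -- Each of the `n` circles through `r` and `s` other than `D` meets one of the `n - 1` circles of
  -- the flock in an odd number of points, so two of them meet the same one in this way.
  have hodd : ∀ E ∈ bundle 𝒞 r s \ {D}, ∃ C, C ∈ F ∧ Odd (C ∩ E).ncard := fun E hE =>
    h.exists_odd_inter_flock he hF hE.1.1 (hoff p (.inl rfl) E hE) (hoff q (.inr rfl) E hE)
  choose! f hf hfodd using hodd
  have hcard : F.ncard < (bundle 𝒞 r s \ {D}).ncard := by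
    have hDrs : D ∈ bundle 𝒞 r s := ⟨hD.1, hr.1, hs.1⟩
    rw [Set.ncard_sdiff_singleton_of_mem hDrs, h.ncard_bundle hrs, h.ncard_flock hF]
    have := h.two_le
    omega
  obtain ⟨E, hE, E', hE', hne, hff⟩ := Set.exists_ne_map_eq_of_ncard_lt_of_maps_to hcard hf
  exact ⟨f E, hf E hE, h.areInverse_of_odd he (hF.subset_circles (hf E hE)) hrs hE.1 hE'.1 hne
    (hfodd E hE) (hff ▸ hfodd E' hE')⟩

theorem isTangent_of_mem_flock_of_notMem (h : IsInversivePlane n 𝒞) (he : Even n)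
    (hF : IsFlock 𝒞 p q F) (hC : C ∈ F) (hD : D ∈ bundle 𝒞 p q) (hr : r ∈ D \ {p, q})
    (hrC : r ∉ C) : IsTangent C D := by
  have := h.finite
  obtain ⟨C₀, ⟨hC₀, hrC₀⟩, -⟩ := hF.existsUnique_mem hr.2
  have hinverse : ∀ s ∈ (D \ {p, q}) \ {r}, ∃ C, C ∈ F ∧ AreInverse 𝒞 C r s := fun s hs =>
    h.exists_mem_flock_areInverse he hF hD hr hs.1 (Ne.symm hs.2)
  choose! f hf hfinv using hinverse
  have hinj : Set.InjOn f ((D \ {p, q}) \ {r}) := fun s hs t ht hst =>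
    AreInverse.unique h (hF.subset_circles (hf s hs)) (hfinv s hs) (hst ▸ hfinv t ht)
  have himage : f '' ((D \ {p, q}) \ {r}) = F \ {C₀} := by
    refine Set.eq_of_subset_of_ncard_le (Set.image_subset_iff.2 fun s hs => ⟨hf s hs, ?_⟩) ?_
    · rintro rfl
      exact (hfinv s hs).left_notMem hrC₀
    · rw [hinj.ncard_image, Set.ncard_sdiff_singleton_of_mem hC₀, h.ncard_flock hF,
        Set.ncard_sdiff_singleton_of_mem hr, h.ncard_sdiff_pair hF.carriers_ne hD]
  have hne : C ≠ C₀ := fun e => hrC (e ▸ hrC₀)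
  obtain ⟨s, hs, rfl⟩ := himage.ge ⟨hC, hne⟩
  exact (hfinv s hs).isTangent D ⟨hD.1, hr.1, hs.1.1⟩

theorem areInverse_of_mem_flock (h : IsInversivePlane n 𝒞) (he : Even n) (hF : IsFlock 𝒞 p q F)
    (hC : C ∈ F) : AreInverse 𝒞 C p q := by
  have hpC : p ∉ C := fun hp => hF.subset_compl hC hp (.inl rfl)
  have hqC : q ∉ C := fun hq => hF.subset_compl hC hq (.inr rfl)
  refine ⟨hF.carriers_ne, hpC, hqC, fun D hD => ?_⟩
  by_cases hsub : D \ {p, q} ⊆ C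
  · have hinter : C ∩ D = D \ {p, q} := by
      refine Set.Subset.antisymm (fun a ha => ⟨ha.2, hF.subset_compl hC ha.1⟩)
        (Set.subset_inter hsub Set.sdiff_subset)
    refine h.isTangent_of_odd (hF.subset_circles hC) hD.1 (fun e => hpC (e ▸ hD.2.1)) ?_
    rw [hinter, h.ncard_sdiff_pair hF.carriers_ne hD]
    exact Nat.Even.sub_odd (by have := h.two_le; omega) he odd_one
  · obtain ⟨r, hr, hrC⟩ := Set.not_subset.1 hsub
    exact h.isTangent_of_mem_flock_of_notMem he hF hC hD hr hrC

theorem isFlock_iff (h : IsInversivePlane n 𝒞) (he : Even n) (hpq : p ≠ q) :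
    IsFlock 𝒞 p q F ↔ F = {C ∈ 𝒞 | AreInverse 𝒞 C p q} := by
  constructor
  · refine fun hF => Set.Subset.antisymm
      (fun C hC => ⟨hF.subset_circles hC, h.areInverse_of_mem_flock he hF hC⟩) ?_
    rintro C ⟨hC, hinv⟩
    obtain ⟨r, hr⟩ := h.nonempty hC
    obtain ⟨C₀, ⟨hC₀, hr₀⟩, -⟩ := hF.existsUnique_mem (a := r) (by
      rintro (rfl | rfl)
      exacts [hinv.left_notMem hr, hinv.right_notMem hr])
    rwa [AreInverse.eq_of_mem h he hC (hF.subset_circles hC₀) hinv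
      (h.areInverse_of_mem_flock he hF hC₀) hr hr₀]
  · rintro rfl
    refine ⟨hpq, fun C hC => hC.1, fun C hC D hD hne => Set.disjoint_left.2 fun a haC haD =>
      hne (AreInverse.eq_of_mem h he hC.1 hD.1 hC.2 hD.2 haC haD), Set.ext fun a => ⟨?_, ?_⟩⟩
    · rintro ⟨C, ⟨-, hinv⟩, haC⟩ (rfl | rfl)
      exacts [hinv.left_notMem haC, hinv.right_notMem haC]
    · intro ha
      obtain ⟨C, hC, haC, hinv⟩ := h.exists_areInverse_of_mem he hpq
        (fun e => ha (.inl e.symm)) (fun e => ha (.inr e.symm))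
      exact ⟨C, ⟨hC, hinv⟩, haC⟩

end Flock

end IsInversivePlane

namespace Unital

variable {P : Type*} {n : ℕ} {U : Unital P n} {x y z w p q : P} {K L M M' M'' : Set P}
  {A B C D : U.Pencil x}

theorem finite_points (U : Unital P n) : Finite P :=
  Nat.finite_of_card_ne_zero (by rw [U.card_points]; exact Nat.succ_ne_zero _)

theorem finite_pencil (U : Unital P n) (x : P) : Finite (U.Pencil x) :=
  have := U.finite_points
  inferInstanceAs (Finite {K // K ∈ U.lines ∧ x ∈ K})

theorem nonempty_of_mem_lines (hL : L ∈ U.lines) : L.Nonempty :=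
  Set.nonempty_of_ncard_ne_zero (by rw [U.card_line L hL]; exact n.succ_ne_zero)

theorem ne_of_disjoint (hL : L ∈ U.lines) (hLM : Disjoint L M) : L ≠ M := by
  rintro rfl
  exact (nonempty_of_mem_lines hL).ne_empty (disjoint_self.1 hLM)

theorem line_eq_of_mem (hK : K ∈ U.lines) (hL : L ∈ U.lines) (hpq : p ≠ q) (hpK : p ∈ K)
    (hqK : q ∈ K) (hpL : p ∈ L) (hqL : q ∈ L) : K = L :=
  (U.existsUnique_line p q hpq).unique ⟨hK, hpK, hqK⟩ ⟨hL, hpL, hqL⟩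

theorem point_eq_of_mem (hK : K ∈ U.lines) (hL : L ∈ U.lines) (hKL : K ≠ L) (hpK : p ∈ K)
    (hqK : q ∈ K) (hpL : p ∈ L) (hqL : q ∈ L) : p = q := by
  by_contra hpq
  exact hKL (line_eq_of_mem hK hL hpq hpK hqK hpL hqL)

theorem Pencil.ext (h : A.1 = B.1) : A = B :=
  Subtype.ext h

theorem Pencil.eq_of_mem (hpx : p ≠ x) (hA : p ∈ A.1) (hB : p ∈ B.1) : A = B :=
  Pencil.ext (line_eq_of_mem A.2.1 B.2.1 hpx hA A.2.2 hB B.2.2)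

theorem existsUnique_pencil (U : Unital P n) (hpx : p ≠ x) : ∃! K : U.Pencil x, p ∈ K.1 := by
  obtain ⟨K, ⟨hK, hpK, hxK⟩, -⟩ := U.existsUnique_line p x hpx
  exact ⟨⟨K, hK, hxK⟩, hpK, fun _ hp => Pencil.eq_of_mem hpx hp hpK⟩

theorem card_pencil (U : Unital P n) (hn : n ≠ 0) (x : P) : Nat.card (U.Pencil x) = n ^ 2 := by
  have := U.finite_points
  have := U.finite_pencil x
  have hcount := ncard_eq_mul_of_existsUnique (S := {x}ᶜ) (T := Set.univ)
    (C := fun K : U.Pencil x => K.1) (k := n)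
    (fun p hp => by simpa using U.existsUnique_pencil hp)
    (fun K _ => by
      rw [Set.inter_comm, ← Set.sdiff_eq, Set.ncard_sdiff_singleton_of_mem K.2.2,
        U.card_line K.1 K.2.1, Nat.add_sub_cancel])
  rw [Set.ncard_compl, U.card_points, Set.ncard_singleton, Nat.add_sub_cancel, pow_succ,
    Set.ncard_univ] at hcount
  exact (Nat.eq_of_mul_eq_mul_right (Nat.pos_of_ne_zero hn) hcount).symm

/-- The lines through `x` that meet `M`; for `M` missing `x` this is the circle of the inversive
plane at `x` determined by `M`, as a set of lines. -/
def star (U : Unital P n) (x : P) (M : Set P) : Set (U.Pencil x) :=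
  {K | (K.1 ∩ M).Nonempty}

theorem mem_star_of_mem (hpA : p ∈ A.1) (hpM : p ∈ M) : A ∈ U.star x M :=
  ⟨p, hpA, hpM⟩

theorem mem_star_comm {E : U.Pencil y} : A ∈ U.star x E.1 ↔ E ∈ U.star y A.1 := by
  rw [star, star, Set.mem_ofPred_eq, Set.mem_ofPred_eq, Set.inter_comm]

theorem ncard_star (hM : M ∈ U.lines) (hx : x ∉ M) : (U.star x M).ncard = n + 1 := by
  have := U.finite_points
  have := U.finite_pencil x
  have hcount := ncard_eq_mul_of_existsUnique (S := M) (T := U.star x M)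
    (C := fun K : U.Pencil x => K.1) (k := 1)
    (fun p hp => by
      obtain ⟨K, hpK, hK⟩ := U.existsUnique_pencil (ne_of_mem_of_not_mem hp hx)
      exact ⟨K, ⟨mem_star_of_mem hpK hp, hpK⟩, fun K' hK' => hK K' hK'.2⟩)
    (fun K hK => by
      obtain ⟨p, hpK, hpM⟩ := hK
      refine Set.ncard_eq_one.2 ⟨p, Set.eq_singleton_iff_unique_mem.2 ⟨⟨hpM, hpK⟩, ?_⟩⟩
      exact fun q hq => point_eq_of_mem hM K.2.1 (fun e => hx (e ▸ K.2.2)) hq.1 hpM hq.2 hpK)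
  rw [U.card_line M hM, mul_one] at hcount
  exact hcount.symm

theorem parallel_iff_star_eq (hM : M ∈ U.lines) (hx : x ∉ M) (hM' : M' ∈ U.lines) (hx' : x ∉ M') :
    U.Parallel x M M' ↔ U.star x M = U.star x M' :=
  ⟨fun h => Set.ext fun K => h.2.2 K.1 K.2.1 K.2.2,
    fun h => ⟨⟨hM, hx⟩, ⟨hM', hx'⟩, fun K hK hxK => Set.ext_iff.1 h ⟨K, hK, hxK⟩⟩⟩

theorem parallel_of_star_subset (hM : M ∈ U.lines) (hx : x ∉ M) (hM' : M' ∈ U.lines)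
    (hx' : x ∉ M') (h : U.star x M ⊆ U.star x M') : U.Parallel x M M' := by
  have := U.finite_pencil x
  exact (parallel_iff_star_eq hM hx hM' hx').2 (Set.eq_of_subset_of_ncard_le h
    (by rw [ncard_star hM hx, ncard_star hM' hx']))

namespace Parallel

theorem left_mem (h : U.Parallel x M M') : M ∈ U.lines := h.1.1

theorem left_notMem (h : U.Parallel x M M') : x ∉ M := h.1.2

theorem right_mem (h : U.Parallel x M M') : M' ∈ U.lines := h.2.1.1

theorem right_notMem (h : U.Parallel x M M') : x ∉ M' := h.2.1.2

theorem star_eq (h : U.Parallel x M M') : U.star x M = U.star x M' :=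
  (parallel_iff_star_eq h.left_mem h.left_notMem h.right_mem h.right_notMem).1 h

theorem symm (h : U.Parallel x M M') : U.Parallel x M' M :=
  ⟨h.2.1, h.1, fun K hK hx => (h.2.2 K hK hx).symm⟩

theorem trans (h : U.Parallel x M M') (h' : U.Parallel x M' M'') : U.Parallel x M M'' :=
  ⟨h.1, h'.2.1, fun K hK hx => (h.2.2 K hK hx).trans (h'.2.2 K hK hx)⟩

end Parallel

theorem forall_parallel_iff {N : Set P} (hL : L ∈ U.lines) (hM : M ∈ U.lines)
    (hLN : Disjoint L N) (hMN : Disjoint M N) :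
    (∀ z ∈ N, U.Parallel z L M) ↔
      ∀ K ∈ U.lines, (K ∩ N).Nonempty → ((K ∩ L).Nonempty ↔ (K ∩ M).Nonempty) := by
  refine ⟨fun h K hK ⟨z, hzK, hzN⟩ => (h z hzN).2.2 K hK hzK, fun h z hz => ?_⟩
  exact ⟨⟨hL, Set.disjoint_right.1 hLN hz⟩, ⟨hM, Set.disjoint_right.1 hMN hz⟩,
    fun K hK hzK => h K hK ⟨z, hzK, hz⟩⟩

theorem ConditionI.false_of_mem_star (hI : U.ConditionI) {E F : U.Pencil y} (hAB : A ≠ B)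
    (hEF : E ≠ F) (hyA : y ∉ A.1) (hyB : y ∉ B.1) (hxE : x ∉ E.1) (hxF : x ∉ F.1)
    (hAE : A ∈ U.star x E.1) (hAF : A ∈ U.star x F.1) (hBE : B ∈ U.star x E.1)
    (hBF : B ∈ U.star x F.1) : False := by
  have hxAB : ∀ q ∈ A.1, q ∈ B.1 → q = x := fun q hqA hqB => by
    by_contra hqx
    exact hAB (Pencil.eq_of_mem hqx hqA hqB)
  have hyEF : ∀ q ∈ E.1, q ∈ F.1 → q = y := fun q hqE hqF => by
    by_contra hqy
    exact hEF (Pencil.eq_of_mem hqy hqE hqF)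
  have hlines : A.1 ≠ B.1 ∧ E.1 ≠ F.1 ∧ A.1 ≠ E.1 ∧ A.1 ≠ F.1 ∧ B.1 ≠ E.1 ∧ B.1 ≠ F.1 :=
    ⟨fun e => hAB (Pencil.ext e), fun e => hEF (Pencil.ext e), fun e => hxE (e ▸ A.2.2),
      fun e => hxF (e ▸ A.2.2), fun e => hxE (e ▸ B.2.2), fun e => hxF (e ▸ B.2.2)⟩
  have hmeetAB : (A.1 ∩ B.1).Nonempty := ⟨x, A.2.2, B.2.2⟩
  have hmeetEF : (E.1 ∩ F.1).Nonempty := ⟨y, E.2.2, F.2.2⟩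
  refine hI ⟨![A.1, B.1, E.1, F.1], ?_, ?_, ?_, ?_⟩
  · intro i j hij
    fin_cases i <;> fin_cases j <;> simp_all [eq_comm]
  · simp [Fin.forall_fin_succ, A.2.1, B.2.1, E.2.1, F.2.1]
  · intro i j hij
    fin_cases i <;> fin_cases j <;>
      first | exact absurd rfl hij | assumption | (rw [Set.inter_comm]; assumption)
  · intro i j k hij hik hjk
    rw [Set.eq_empty_iff_forall_notMem]
    rintro q ⟨⟨hqi, hqj⟩, hqk⟩
    have hq : ∀ i : Fin 4, q ∈ ![A.1, B.1, E.1, F.1] i ↔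
        (i = 0 ∧ q ∈ A.1) ∨ (i = 1 ∧ q ∈ B.1) ∨ (i = 2 ∧ q ∈ E.1) ∨ (i = 3 ∧ q ∈ F.1) := by
      intro i
      fin_cases i <;> simp
    rw [hq] at hqi hqj hqk
    grind

theorem exists_parallel (hII : U.ConditionII) (hM : M ∈ U.lines) (hx : x ∉ M)
    (hD : D ∈ U.star x M) (hy : y ∈ D.1) (hyx : y ≠ x) :
    ∃ M' : U.Pencil y, U.Parallel x M M'.1 := by
  obtain ⟨M', hM', hyM', hx', h⟩ := hII x D.1 D.2.1 M hM D.2.2 hx hD y hy hyx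
  exact ⟨⟨M', hM', hyM'⟩, parallel_of_star_subset hM hx hM' hx' fun K => h K.1 K.2.1 K.2.2⟩

theorem Parallel.eq_of_mem (hn : 2 ≤ n) (hI : U.ConditionI) (h : U.Parallel x M M') (hp : p ∈ M)
    (hp' : p ∈ M') : M = M' := by
  have := U.finite_pencil x
  by_contra hne
  have hpx : p ≠ x := ne_of_mem_of_not_mem hp h.left_notMem
  obtain ⟨D, hpD, -⟩ := U.existsUnique_pencil hpx
  have hcard : 1 < (U.star x M \ {D}).ncard := by
    rw [Set.ncard_sdiff_singleton_of_mem (mem_star_of_mem hpD hp),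
      ncard_star h.left_mem h.left_notMem]
    omega
  obtain ⟨A, B, ⟨hA, hAD⟩, ⟨hB, hBD⟩, hAB⟩ := (Set.one_lt_ncard_iff).1 hcard
  exact hI.false_of_mem_star (E := ⟨M, h.left_mem, hp⟩) (F := ⟨M', h.right_mem, hp'⟩) hAB
    (fun e => hne (congrArg Subtype.val e)) (fun hpA => hAD (Pencil.eq_of_mem hpx hpA hpD))
    (fun hpB => hBD (Pencil.eq_of_mem hpx hpB hpD)) h.left_notMem h.right_notMem hA
    (h.star_eq ▸ hA) hB (h.star_eq ▸ hB)

theorem Parallel.disjoint (hn : 2 ≤ n) (hI : U.ConditionI) (h : U.Parallel x M M')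
    (hne : M ≠ M') : Disjoint M M' :=
  Set.disjoint_left.2 fun _ hp hp' => hne (h.eq_of_mem hn hI hp hp')

theorem parallel_of_mem_star (hI : U.ConditionI) (hII : U.ConditionII) (hM : M ∈ U.lines)
    (hx : x ∉ M) (hM' : M' ∈ U.lines) (hx' : x ∉ M') (hAB : A ≠ B) (hAC : A ≠ C) (hBC : B ≠ C)
    (hA : A ∈ U.star x M) (hB : B ∈ U.star x M) (hC : C ∈ U.star x M) (hA' : A ∈ U.star x M')
    (hB' : B ∈ U.star x M') (hC' : C ∈ U.star x M') : U.Parallel x M M' := by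
  obtain ⟨y, hyA, hyM⟩ := id hA
  have hyx : y ≠ x := ne_of_mem_of_not_mem hyM hx
  obtain ⟨N, hN⟩ := exists_parallel hII hM' hx' hA' hyA hyx
  suffices hMN : ⟨M, hM, hyM⟩ = N from (congrArg Subtype.val hMN ▸ hN).symm
  by_contra hMN
  rw [hN.star_eq] at hB' hC'
  exact hI.false_of_mem_star hBC hMN (fun hyB => hAB (Pencil.eq_of_mem hyx hyA hyB))
    (fun hyC => hAC (Pencil.eq_of_mem hyx hyA hyC)) hx hN.right_notMem hB hB' hC hC'

theorem Parallel.center_unique (hn : 2 ≤ n) (hI : U.ConditionI) (hLM : Disjoint L M)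
    (hz : U.Parallel z L M) (hw : U.Parallel w L M) (hK : K ∈ U.lines) (hKL : (K ∩ L).Nonempty)
    (hzK : z ∈ K) (hwK : w ∈ K) : z = w := by
  by_contra hzw
  obtain ⟨x, hxK, hxL⟩ := id hKL
  obtain ⟨y, hyK, hyM⟩ := (hz.2.2 K hK hzK).1 hKL
  have hLK : L ≠ K := fun e => hz.left_notMem (e ▸ hzK)
  have hMK : M ≠ K := fun e => hz.right_notMem (e ▸ hzK)
  obtain ⟨p, hpM, hpy⟩ : ∃ p ∈ M, p ≠ y :=
    Set.exists_ne_of_one_lt_ncard (by rw [U.card_line M hz.right_mem]; omega) y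
  have hpK : p ∉ K := fun hpK => hpy (point_eq_of_mem hz.right_mem hK hMK hpM hyM hpK hyK)
  have hmissing : ∀ {v : P} {J : U.Pencil p}, U.Parallel v L M → v ∈ K → v ∈ J.1 →
      x ∉ J.1 ∧ (⟨L, hz.left_mem, hxL⟩ : U.Pencil x) ∈ U.star x J.1 := fun {v J} hv hvK hvJ => by
    have hvx : v ≠ x := fun e => hv.left_notMem (e ▸ hxL)
    refine ⟨fun hxJ => hpK ?_, ?_⟩
    · exact line_eq_of_mem J.2.1 hK hvx hvJ hxJ hvK hxK ▸ J.2.2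
    · exact mem_star_comm.2 ((hv.2.2 J.1 J.2.1 hvJ).2 ⟨p, J.2.2, hpM⟩)
  obtain ⟨J, hzJ, -⟩ := U.existsUnique_pencil fun e : z = p => hpK (e ▸ hzK)
  obtain ⟨G, hwG, -⟩ := U.existsUnique_pencil fun e : w = p => hpK (e ▸ hwK)
  have hJG : J ≠ G := by
    rintro rfl
    exact hpK (line_eq_of_mem J.2.1 hK hzw hzJ hwG hzK hwK ▸ J.2.2)
  obtain ⟨hxJ, hLJ⟩ := hmissing hz hzK hzJ
  obtain ⟨hxG, hLG⟩ := hmissing hw hwK hwG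
  exact hI.false_of_mem_star (B := ⟨K, hK, hxK⟩) (fun e => hLK (congrArg Subtype.val e)) hJG
    (Set.disjoint_right.1 hLM hpM) hpK hxJ hxG hLJ hLG ⟨z, hzK, hzJ⟩ ⟨w, hwK, hwG⟩

/-- The standing assumptions on `U`: Wilbrink's conditions (I) and (II), and order at least `2`. -/
structure IsWilbrink (U : Unital P n) : Prop where
  two_le : 2 ≤ n
  conditionI : U.ConditionI
  conditionII : U.ConditionII

theorem notMem_blockOf : C ∉ U.blockOf x A B ↔ (C ≠ A ∧ C ≠ B) ∧
    ∃ M ∈ U.lines, x ∉ M ∧ A ∈ U.star x M ∧ B ∈ U.star x M ∧ C ∈ U.star x M := by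
  simp only [blockOf, star, Set.mem_union, Set.mem_insert_iff, Set.mem_singleton_iff,
    Set.mem_ofPred_eq, not_or, not_not, Set.inter_comm]

theorem left_mem_blockOf (A B : U.Pencil x) : A ∈ U.blockOf x A B :=
  .inl (.inl rfl)

theorem right_mem_blockOf (A B : U.Pencil x) : B ∈ U.blockOf x A B :=
  .inl (.inr rfl)

theorem blockOf_comm (A B : U.Pencil x) : U.blockOf x A B = U.blockOf x B A := by
  ext C
  rw [← not_iff_not, notMem_blockOf, notMem_blockOf, and_comm (a := C ≠ A)]
  simp only [and_left_comm (a := A ∈ _)]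

theorem IsWilbrink.ncard_compl_blockOf (h : U.IsWilbrink) (hDA : D ≠ A) :
    (U.blockOf x D A)ᶜ.ncard = n * (n - 1) := by
  have := U.finite_pencil x
  obtain ⟨y, hyD, hyx⟩ : ∃ y ∈ D.1, y ≠ x :=
    Set.exists_ne_of_one_lt_ncard (by rw [U.card_line D.1 D.2.1]; have := h.two_le; omega) x
  have := U.finite_pencil y
  have hyA : y ∉ A.1 := fun hyA => hDA (Pencil.eq_of_mem hyx hyD hyA)
  let E : U.Pencil y := ⟨D.1, D.2.1, hyD⟩
  have hxM : ∀ {M : U.Pencil y}, M ≠ E → x ∉ M.1 := fun hME hxM =>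
    hME (Pencil.eq_of_mem hyx.symm hxM D.2.2)
  have hEA : E ∈ U.star y A.1 := mem_star_of_mem D.2.2 A.2.2
  have hcount := ncard_eq_mul_of_existsUnique (S := (U.blockOf x D A)ᶜ) (T := U.star y A.1 \ {E})
    (C := fun M : U.Pencil y => U.star x M.1) (k := n - 1) (fun B hB => ?_) (fun M hM => ?_)
  · rwa [Set.ncard_sdiff_singleton_of_mem hEA, ncard_star A.2.1 hyA] at hcount
  · obtain ⟨⟨hBD, hBA⟩, M₀, hM₀, hx₀, hD₀, hA₀, hB₀⟩ := notMem_blockOf.1 hB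
    obtain ⟨M, hM⟩ := exists_parallel h.conditionII hM₀ hx₀ hD₀ hyD hyx
    rw [hM.star_eq] at hA₀ hB₀
    have hME : M ≠ E := fun e => hM.right_notMem (e ▸ D.2.2)
    refine ⟨M, ⟨⟨mem_star_comm.1 hA₀, hME⟩, hB₀⟩, fun M' hM' => ?_⟩
    by_contra hne
    exact h.conditionI.false_of_mem_star hBA.symm hne hyA
      (fun hyB => hBD (Pencil.eq_of_mem hyx hyB hyD)) (hxM hM'.1.2) (hxM hME)
      (mem_star_comm.2 hM'.1.1) hA₀ hM'.2 hB₀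
  · have hDM : D ∈ U.star x M.1 := mem_star_of_mem hyD M.2.2
    have hAM : A ∈ U.star x M.1 := mem_star_comm.2 hM.1
    have hinter : (U.blockOf x D A)ᶜ ∩ U.star x M.1 = U.star x M.1 \ {D, A} := by
      ext B
      rw [Set.mem_inter_iff, Set.mem_compl_iff, notMem_blockOf, Set.mem_sdiff,
        Set.mem_insert_iff, Set.mem_singleton_iff, not_or]
      exact ⟨fun hB => ⟨hB.2, hB.1.1⟩,
        fun hB => ⟨⟨hB.2, M.1, M.2.1, hxM hM.2, hDM, hAM, hB.1⟩, hB.1⟩⟩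
    rw [hinter, Set.ncard_sdiff (Set.pair_subset hDM hAM), ncard_star M.2.1 (hxM hM.2),
      Set.ncard_pair hDA]
    omega

theorem IsWilbrink.ncard_blockOf (h : U.IsWilbrink) (hAB : A ≠ B) :
    (U.blockOf x A B).ncard = n := by
  have := U.finite_pencil x
  have hn := h.two_le
  have hcompl := Set.ncard_add_ncard_compl (U.blockOf x A B)
  rw [h.ncard_compl_blockOf hAB, U.card_pencil (by omega)] at hcompl
  obtain ⟨m, rfl⟩ := Nat.exists_eq_add_of_le hn
  rw [show 2 + m - 1 = m + 1 by omega] at hcompl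
  nlinarith

/-- The lines through `x` that are parallel to `M` with respect to some point of `D`. Together with
`D` they form a block when `D` meets `M` and `x` is not on `M`. -/
def parallels (D : U.Pencil x) (M : Set P) : Set (U.Pencil x) :=
  {A | ∃ z ∈ D.1, U.Parallel z A.1 M}

theorem notMem_parallels (D : U.Pencil x) (M : Set P) : D ∉ parallels D M :=
  fun ⟨_, hz, hpar⟩ => hpar.left_notMem hz

theorem IsWilbrink.ncard_parallels (h : U.IsWilbrink) (hM : M ∈ U.lines) (hx : x ∉ M)
    (hD : D ∈ U.star x M) : (parallels D M).ncard = n - 1 := by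
  have := U.finite_points
  have := U.finite_pencil x
  obtain ⟨y, hyD, hyM⟩ := id hD
  have hcount := ncard_eq_mul_of_existsUnique (S := parallels D M) (T := D.1 \ {x, y})
    (C := fun z => {A : U.Pencil x | U.Parallel z A.1 M}) (k := 1) (fun A hA => ?_)
    (fun z hz => ?_)
  · rw [hcount, mul_one, Set.ncard_sdiff (Set.pair_subset D.2.2 hyD),
      Set.ncard_pair (ne_of_mem_of_not_mem hyM hx).symm, U.card_line D.1 D.2.1]
    omega
  · obtain ⟨z, hzD, hz⟩ := hA
    have hAM : Disjoint A.1 M :=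
      hz.disjoint h.two_le h.conditionI fun e => hx (e ▸ A.2.2)
    refine ⟨z, ⟨⟨hzD, ?_⟩, hz⟩, fun w hw => (hz.center_unique h.two_le h.conditionI hAM hw.2 D.2.1
      ⟨x, D.2.2, A.2.2⟩ hzD hw.1.1).symm⟩
    rintro (rfl | rfl)
    · exact hz.left_notMem A.2.2
    · exact hz.right_notMem hyM
  · obtain ⟨hzD, hz⟩ := hz
    simp only [Set.mem_insert_iff, Set.mem_singleton_iff, not_or] at hz
    have hzM : z ∉ M := fun hzM => hz.2 (point_eq_of_mem hM D.2.1 (fun e => hx (e ▸ D.2.2)) hzM hyM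
      hzD hyD)
    obtain ⟨A, hA⟩ := exists_parallel h.conditionII (D := ⟨D.1, D.2.1, hzD⟩) hM hzM hD D.2.2
      (Ne.symm hz.1)
    refine Set.ncard_eq_one.2 ⟨A, Set.eq_singleton_iff_unique_mem.2
      ⟨⟨⟨z, hzD, hA.symm⟩, hA.symm⟩, fun B hB => Pencil.ext ?_⟩⟩
    exact (Parallel.trans hB.2 hA).eq_of_mem h.two_le h.conditionI B.2.2 A.2.2

theorem IsWilbrink.mem_blockOf_of_mem_parallels (h : U.IsWilbrink) (hx : x ∉ M)
    (hA : A ∈ parallels D M) (hB : B ∈ parallels D M) : B ∈ U.blockOf x D A := by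
  by_contra hB'
  obtain ⟨⟨-, hBA⟩, J₀, hJ₀, hx₀, hDJ₀, hAJ₀, hBJ₀⟩ := notMem_blockOf.1 hB'
  obtain ⟨z, hzD, hz⟩ := hA
  obtain ⟨w, hwD, hw⟩ := hB
  have hzw : z ≠ w := by
    rintro rfl
    exact hBA (Pencil.ext ((hw.trans hz.symm).eq_of_mem h.two_le h.conditionI B.2.2 A.2.2))
  have hzx : z ≠ x := fun e => hz.left_notMem (e ▸ A.2.2)
  have hwx : w ≠ x := fun e => hw.left_notMem (e ▸ B.2.2)
  have hBD : B ≠ D := fun e => hw.left_notMem (e ▸ hwD)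
  obtain ⟨J, hJ⟩ := exists_parallel h.conditionII hJ₀ hx₀ hDJ₀ hzD hzx
  rw [hJ.star_eq] at hAJ₀ hBJ₀
  obtain ⟨p, hpJ, hpM⟩ := (hz.2.2 J.1 J.2.1 J.2.2).1 (mem_star_comm.1 hAJ₀)
  have hpD : p ∉ D.1 := fun hpD => hz.right_notMem <| point_eq_of_mem J.2.1 D.2.1
    (fun e => hJ.right_notMem (e ▸ D.2.2)) hpJ J.2.2 hpD hzD ▸ hpM
  have hBM : Disjoint B.1 M := hw.disjoint h.two_le h.conditionI fun e => hx (e ▸ B.2.2)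
  obtain ⟨G, hwG, -⟩ := U.existsUnique_pencil (ne_of_mem_of_not_mem hpM hw.right_notMem).symm
  have hJG : (⟨J.1, J.2.1, hpJ⟩ : U.Pencil p) ≠ G := by
    rintro rfl
    exact hpD (line_eq_of_mem J.2.1 D.2.1 hzw J.2.2 hwG hzD hwD ▸ hpJ)
  have hxG : x ∉ G.1 := fun hxG =>
    hpD (line_eq_of_mem G.2.1 D.2.1 hwx hwG hxG hwD D.2.2 ▸ G.2.2)
  exact h.conditionI.false_of_mem_star hBD hJG (Set.disjoint_right.1 hBM hpM) hpD hJ.right_notMem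
    hxG hBJ₀ (mem_star_comm.2 ((hw.2.2 G.1 G.2.1 hwG).2 ⟨p, G.2.2, hpM⟩)) ⟨z, hzD, J.2.2⟩
    ⟨w, hwD, hwG⟩

theorem IsWilbrink.blockOf_eq_insert_parallels (h : U.IsWilbrink) (hM : M ∈ U.lines) (hx : x ∉ M)
    (hD : D ∈ U.star x M) (hA : A ∈ parallels D M) :
    U.blockOf x D A = insert D (parallels D M) := by
  have := U.finite_pencil x
  have hDA : D ≠ A := (ne_of_mem_of_not_mem hA (notMem_parallels D M)).symm
  refine (Set.eq_of_subset_of_ncard_le (Set.insert_subset (left_mem_blockOf D A)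
    fun B hB => h.mem_blockOf_of_mem_parallels hx hA hB) ?_).symm
  rw [h.ncard_blockOf hDA, Set.ncard_insert_of_notMem (notMem_parallels D M),
    h.ncard_parallels hM hx hD]
  omega

theorem IsWilbrink.exists_mem_parallels (h : U.IsWilbrink) (hDA : D ≠ A) :
    ∃ M ∈ U.lines, x ∉ M ∧ D ∈ U.star x M ∧ A ∈ parallels D M := by
  have hD := U.card_line D.1 D.2.1
  have hn := h.two_le
  obtain ⟨y, hyD, hyx⟩ : ∃ y ∈ D.1, y ≠ x := Set.exists_ne_of_one_lt_ncard (by omega) x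
  have hcard : 0 < (D.1 \ {x, y}).ncard := by
    rw [Set.ncard_sdiff (Set.pair_subset D.2.2 hyD), Set.ncard_pair hyx.symm]
    omega
  obtain ⟨z, hzD, hz⟩ := Set.nonempty_of_ncard_ne_zero hcard.ne'
  simp only [Set.mem_insert_iff, Set.mem_singleton_iff, not_or] at hz
  have hzA : z ∉ A.1 := fun hzA => hDA (Pencil.eq_of_mem hz.1 hzD hzA)
  obtain ⟨M, hM⟩ := exists_parallel h.conditionII (D := ⟨D.1, D.2.1, hzD⟩) A.2.1 hzA
    (mem_star_of_mem D.2.2 A.2.2) hyD (Ne.symm hz.2)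
  refine ⟨M.1, M.2.1, fun hxM => hM.right_notMem ?_, mem_star_of_mem hyD M.2.2, z, hzD, hM⟩
  exact line_eq_of_mem M.2.1 D.2.1 hyx M.2.2 hxM hyD D.2.2 ▸ hzD

theorem IsWilbrink.blockOf_eq_of_mem_left (h : U.IsWilbrink) (hAB : A ≠ B)
    (hC : C ∈ U.blockOf x A B) (hCA : C ≠ A) : U.blockOf x A B = U.blockOf x A C := by
  obtain ⟨M, hM, hx, hA, hB⟩ := h.exists_mem_parallels hAB
  rw [h.blockOf_eq_insert_parallels hM hx hA hB] at hC ⊢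
  exact (h.blockOf_eq_insert_parallels hM hx hA (hC.resolve_left hCA)).symm

theorem IsWilbrink.blockOf_eq_of_mem (h : U.IsWilbrink) (hAB : A ≠ B) (hCD : C ≠ D)
    (hC : C ∈ U.blockOf x A B) (hD : D ∈ U.blockOf x A B) :
    U.blockOf x A B = U.blockOf x C D := by
  rcases eq_or_ne C A with rfl | hCA
  · exact h.blockOf_eq_of_mem_left hAB hD hCD.symm
  · rw [h.blockOf_eq_of_mem_left hAB hC hCA, blockOf_comm] at hD ⊢
    exact h.blockOf_eq_of_mem_left hCA hD hCD.symm

/-- The circle through `∞` and the lines `A`, `B` through `x`. -/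
def blockCircle (A B : U.Pencil x) : Set (U.InvPoint x) :=
  insert none (some '' U.blockOf x A B)

theorem some_mem_circleOf : some A ∈ U.circleOf x M ↔ A ∈ U.star x M :=
  (Option.some_injective _).mem_set_image

theorem none_notMem_circleOf : none ∉ U.circleOf x M :=
  fun ⟨_, _, h⟩ => Option.some_ne_none _ h

theorem some_mem_blockCircle : some C ∈ blockCircle A B ↔ C ∈ U.blockOf x A B := by
  simp [blockCircle]

theorem none_mem_blockCircle : none ∈ blockCircle A B :=
  Set.mem_insert _ _

theorem circleOf_mem_circles (hM : M ∈ U.lines) (hx : x ∉ M) : U.circleOf x M ∈ U.circles x :=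
  .inl ⟨M, hM, hx, rfl⟩

theorem blockCircle_mem_circles (hAB : A ≠ B) : blockCircle A B ∈ U.circles x :=
  .inr ⟨A, B, hAB, rfl⟩

theorem ncard_circleOf (hM : M ∈ U.lines) (hx : x ∉ M) : (U.circleOf x M).ncard = n + 1 := by
  rw [circleOf, Set.ncard_image_of_injective _ (Option.some_injective _)]
  exact ncard_star hM hx

theorem IsWilbrink.ncard_blockCircle (h : U.IsWilbrink) (hAB : A ≠ B) :
    (blockCircle A B).ncard = n + 1 := by
  have := U.finite_pencil x
  rw [blockCircle, Set.ncard_insert_of_notMem (by simp),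
    Set.ncard_image_of_injective _ (Option.some_injective _), h.ncard_blockOf hAB]

theorem circleOf_eq_iff (hM : M ∈ U.lines) (hx : x ∉ M) (hM' : M' ∈ U.lines) (hx' : x ∉ M') :
    U.circleOf x M = U.circleOf x M' ↔ U.Parallel x M M' := by
  rw [parallel_iff_star_eq hM hx hM' hx']
  exact (Option.some_injective _).image_injective.eq_iff

theorem IsWilbrink.blockCircle_eq (h : U.IsWilbrink) (hAB : A ≠ B) (hCD : C ≠ D)
    (hC : some C ∈ blockCircle A B) (hD : some D ∈ blockCircle A B) :
    blockCircle A B = blockCircle C D := by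
  rw [some_mem_blockCircle] at hC hD
  rw [blockCircle, blockCircle, h.blockOf_eq_of_mem hAB hCD hC hD]

theorem IsWilbrink.existsUnique_circle_none (h : U.IsWilbrink) (hAB : A ≠ B) :
    ∃! C, C ∈ U.circles x ∧ none ∈ C ∧ some A ∈ C ∧ some B ∈ C := by
  refine ⟨blockCircle A B, ⟨blockCircle_mem_circles hAB, none_mem_blockCircle,
    some_mem_blockCircle.2 (left_mem_blockOf A B),
    some_mem_blockCircle.2 (right_mem_blockOf A B)⟩, ?_⟩
  rintro _ ⟨⟨M, -, -, rfl⟩ | ⟨D, E, hDE, rfl⟩, hnone, hA, hB⟩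
  · exact absurd hnone none_notMem_circleOf
  · exact h.blockCircle_eq hDE hAB hA hB

theorem IsWilbrink.existsUnique_circle_some (h : U.IsWilbrink) (hAB : A ≠ B) (hAC : A ≠ C)
    (hBC : B ≠ C) : ∃! E, E ∈ U.circles x ∧ some A ∈ E ∧ some B ∈ E ∧ some C ∈ E := by
  by_cases hC : C ∈ U.blockOf x A B
  · refine ⟨blockCircle A B, ⟨blockCircle_mem_circles hAB,
      some_mem_blockCircle.2 (left_mem_blockOf A B),
      some_mem_blockCircle.2 (right_mem_blockOf A B), some_mem_blockCircle.2 hC⟩, ?_⟩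
    rintro _ ⟨⟨M, hM, hx, rfl⟩ | ⟨D, E, hDE, rfl⟩, hA, hB, hC'⟩
    · simp only [some_mem_circleOf] at hA hB hC'
      exact absurd hC (notMem_blockOf.2 ⟨⟨hAC.symm, hBC.symm⟩, M, hM, hx, hA, hB, hC'⟩)
    · exact h.blockCircle_eq hDE hAB hA hB
  · obtain ⟨-, M, hM, hx, hA, hB, hC'⟩ := notMem_blockOf.1 hC
    refine ⟨U.circleOf x M, ⟨circleOf_mem_circles hM hx, some_mem_circleOf.2 hA,
      some_mem_circleOf.2 hB, some_mem_circleOf.2 hC'⟩, ?_⟩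
    rintro _ ⟨⟨M', hM', hx', rfl⟩ | ⟨D, E, hDE, rfl⟩, hA', hB', hC''⟩
    · simp only [some_mem_circleOf] at hA' hB' hC''
      exact (circleOf_eq_iff hM' hx' hM hx).2 (parallel_of_mem_star h.conditionI h.conditionII hM'
        hx' hM hx hAB hAC hBC hA' hB' hC'' hA hB hC')
    · rw [some_mem_blockCircle.symm, ← h.blockCircle_eq hDE hAB hA' hB'] at hC
      exact absurd hC'' hC

theorem IsWilbrink.isInversivePlane_circles (h : U.IsWilbrink) (x : P) :
    IsInversivePlane n (U.circles x) where
  two_le := h.two_le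
  card_points := by
    have := U.finite_pencil x
    rw [Finite.card_option, U.card_pencil (by have := h.two_le; omega)]
  card_circle := by
    rintro C (⟨M, hM, hx, rfl⟩ | ⟨A, B, hAB, rfl⟩)
    · exact ncard_circleOf hM hx
    · exact h.ncard_blockCircle hAB
  existsUnique_circle := by
    rintro (_ | A) (_ | B) (_ | C) hAB hAC hBC
    · exact absurd rfl hAB
    · exact absurd rfl hAB
    · exact absurd rfl hAC
    · exact h.existsUnique_circle_none fun e => hBC (congrArg some e)
    · exact absurd rfl hBC
    · simpa only [and_left_comm] using h.existsUnique_circle_none fun e => hAC (congrArg some e)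
    · simpa only [and_left_comm, and_comm] using
        h.existsUnique_circle_none fun e => hAB (congrArg some e)
    · exact h.existsUnique_circle_some (fun e => hAB (congrArg some e))
        (fun e => hAC (congrArg some e)) fun e => hBC (congrArg some e)

open IsInversivePlane

theorem IsWilbrink.isTangent_of_mem_parallels (h : U.IsWilbrink) (hM : M ∈ U.lines) (hx : x ∉ M)
    (hB : B ∈ U.star x M) (hA : A ∈ parallels B M) :
    IsTangent (U.circleOf x M) (blockCircle A B) := by
  refine Set.ncard_eq_one.2 ⟨some B, Set.eq_singleton_iff_unique_mem.2
    ⟨⟨some_mem_circleOf.2 hB, some_mem_blockCircle.2 (right_mem_blockOf A B)⟩, ?_⟩⟩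
  rintro (_ | C) ⟨hCM, hCAB⟩
  · exact absurd hCM none_notMem_circleOf
  rw [some_mem_blockCircle, blockOf_comm, h.blockOf_eq_insert_parallels hM hx hB hA] at hCAB
  refine congrArg some (hCAB.resolve_right ?_)
  rintro ⟨z, -, hz⟩
  have hdisj : Disjoint C.1 M := hz.disjoint h.two_le h.conditionI fun e => hx (e ▸ C.2.2)
  exact (some_mem_circleOf.1 hCM).ne_empty hdisj.inter_eq

theorem IsWilbrink.isTangent_iff (h : U.IsWilbrink) (hM : M ∈ U.lines) (hAM : Disjoint A.1 M)
    (hB : B ∈ U.star x M) :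
    IsTangent (U.circleOf x M) (blockCircle A B) ↔ A ∈ parallels B M := by
  have hx : x ∉ M := Set.disjoint_left.1 hAM A.2.2
  refine ⟨fun hAB => ?_, h.isTangent_of_mem_parallels hM hx hB⟩
  have hne : A ≠ B := by
    rintro rfl
    exact hB.ne_empty hAM.inter_eq
  obtain ⟨C, hC⟩ : (parallels B M).Nonempty := by
    refine Set.nonempty_of_ncard_ne_zero ?_
    rw [h.ncard_parallels hM hx hB]
    have := h.two_le
    omega
  have hCB : C ≠ B := ne_of_mem_of_not_mem hC (notMem_parallels B M)
  have hbundle : ∀ {E : U.Pencil x}, E ≠ B →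
      blockCircle E B ∈ bundle (U.circles x) (some B) none := fun hEB =>
    ⟨blockCircle_mem_circles hEB, some_mem_blockCircle.2 (right_mem_blockOf _ B),
      none_mem_blockCircle⟩
  have heq : blockCircle A B = blockCircle C B :=
    ((h.isInversivePlane_circles x).existsUnique_isTangent (circleOf_mem_circles hM hx)
      (some_mem_circleOf.2 hB) none_notMem_circleOf).unique ⟨hbundle hne, hAB⟩
        ⟨hbundle hCB, h.isTangent_of_mem_parallels hM hx hB hC⟩
  have hA : some A ∈ blockCircle C B := heq ▸ some_mem_blockCircle.2 (left_mem_blockOf A B)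
  rw [some_mem_blockCircle, blockOf_comm, h.blockOf_eq_insert_parallels hM hx hB hC] at hA
  exact hA.resolve_left hne

/-- Two disjoint lines are conjugate if they are parallel with respect to two distinct points. The
special spread of a line consists of the line itself and of its conjugates. -/
structure Conjugate (U : Unital P n) (L M : Set P) : Prop where
  disjoint : Disjoint L M
  exists_parallel : ∃ z w, z ≠ w ∧ U.Parallel z L M ∧ U.Parallel w L M

namespace Conjugate

theorem left_mem (h : U.Conjugate L M) : L ∈ U.lines :=
  let ⟨_, _, _, hz, _⟩ := h.exists_parallel
  hz.left_mem

theorem right_mem (h : U.Conjugate L M) : M ∈ U.lines :=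
  let ⟨_, _, _, hz, _⟩ := h.exists_parallel
  hz.right_mem

theorem symm (h : U.Conjugate L M) : U.Conjugate M L :=
  let ⟨z, w, hzw, hz, hw⟩ := h.exists_parallel
  ⟨h.disjoint.symm, z, w, hzw, hz.symm, hw.symm⟩

theorem notMem (h : U.Conjugate L M) (hp : p ∈ L) : p ∉ M :=
  Set.disjoint_left.1 h.disjoint hp

theorem ne (h : U.Conjugate L M) : L ≠ M :=
  ne_of_disjoint h.left_mem h.disjoint

end Conjugate

theorem IsWilbrink.conjugate_of_areInverse (h : U.IsWilbrink) (hM : M ∈ U.lines) (hx : x ∉ M)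
    (hA : AreInverse (U.circles x) (U.circleOf x M) (some A) none) : U.Conjugate A.1 M := by
  have := U.finite_pencil x
  have hAM : Disjoint A.1 M := Set.disjoint_iff_inter_eq_empty.2 <| Set.not_nonempty_iff_eq_empty.1
    fun hA' => hA.left_notMem (some_mem_circleOf.2 hA')
  have hcenter : ∀ {B : U.Pencil x}, B ∈ U.star x M → A ∈ parallels B M := fun {B} hB => by
    have hAB : A ≠ B := by
      rintro rfl
      exact hB.ne_empty hAM.inter_eq
    exact (h.isTangent_iff hM hAM hB).1 (hA.isTangent _ ⟨blockCircle_mem_circles hAB,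
      some_mem_blockCircle.2 (left_mem_blockOf A B), none_mem_blockCircle⟩)
  obtain ⟨B, B', hB, hB', hne⟩ := (Set.one_lt_ncard_iff).1
    (show 1 < (U.star x M).ncard by rw [ncard_star hM hx]; have := h.two_le; omega)
  obtain ⟨z, hzB, hz⟩ := hcenter hB
  obtain ⟨w, hwB', hw⟩ := hcenter hB'
  refine ⟨hAM, z, w, ?_, hz, hw⟩
  rintro rfl
  exact hne (Pencil.eq_of_mem (ne_of_mem_of_not_mem A.2.2 hz.left_notMem).symm hzB hwB')

theorem IsWilbrink.areInverse_of_conjugate (h : U.IsWilbrink) (he : Even n)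
    (hA : U.Conjugate A.1 M) :
    AreInverse (U.circles x) (U.circleOf x M) (some A) none := by
  have hM := hA.right_mem
  have hx : x ∉ M := hA.notMem A.2.2
  have htangent : ∀ z, U.Parallel z A.1 M → ∃ B : U.Pencil x, z ∈ B.1 ∧ B ∈ U.star x M ∧
      blockCircle A B ∈ bundle (U.circles x) (some A) none ∧
      IsTangent (U.circleOf x M) (blockCircle A B) := fun z hz => by
    obtain ⟨B, hzB, -⟩ :=
      U.existsUnique_pencil (ne_of_mem_of_not_mem A.2.2 hz.left_notMem).symm
    have hB : B ∈ U.star x M := (hz.2.2 B.1 B.2.1 hzB).1 ⟨x, B.2.2, A.2.2⟩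
    have hAB : A ≠ B := fun e => hz.left_notMem (e ▸ hzB)
    exact ⟨B, hzB, hB, ⟨blockCircle_mem_circles hAB,
      some_mem_blockCircle.2 (left_mem_blockOf A B), none_mem_blockCircle⟩,
      h.isTangent_of_mem_parallels hM hx hB ⟨z, hzB, hz⟩⟩
  obtain ⟨z, w, hzw, hz, hw⟩ := hA.exists_parallel
  obtain ⟨B, hzB, hB, hmem, htan⟩ := htangent z hz
  obtain ⟨B', hwB', hB', hmem', htan'⟩ := htangent w hw
  have hBB' : B ≠ B' := by
    rintro rfl
    exact hzw (hz.center_unique h.two_le h.conditionI hA.disjoint hw B.2.1 ⟨x, B.2.2, A.2.2⟩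
      hzB hwB')
  refine (h.isInversivePlane_circles x).areInverse_of_isTangent he (circleOf_mem_circles hM hx)
    (fun e => hBB' (Option.some_injective _ ?_)) (by simp)
    (fun hA' => (some_mem_circleOf.1 hA').ne_empty hA.disjoint.inter_eq) none_notMem_circleOf hmem
    hmem' htan htan'
  exact htan.eq_of_mem (some_mem_circleOf.2 hB) (some_mem_blockCircle.2 (right_mem_blockOf A B))
    (some_mem_circleOf.2 hB') (e ▸ some_mem_blockCircle.2 (right_mem_blockOf A B'))

theorem IsWilbrink.areInverse_iff_conjugate (h : U.IsWilbrink) (he : Even n) (hM : M ∈ U.lines)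
    (hx : x ∉ M) :
    AreInverse (U.circles x) (U.circleOf x M) (some A) none ↔ U.Conjugate A.1 M :=
  ⟨h.conjugate_of_areInverse hM hx, h.areInverse_of_conjugate he⟩

theorem IsWilbrink.exists_center (h : U.IsWilbrink) (he : Even n) (hL : L ∈ U.lines)
    (hM : M ∈ U.lines) (hLM : Disjoint L M) : ∃ z, U.Parallel z L M := by
  obtain ⟨x, hxL⟩ := nonempty_of_mem_lines hL
  have hx : x ∉ M := Set.disjoint_left.1 hLM hxL
  let A : U.Pencil x := ⟨L, hL, hxL⟩
  obtain ⟨D, ⟨hD, hnone, hA⟩, htan⟩ := (h.isInversivePlane_circles x).exists_isTangent he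
    (circleOf_mem_circles hM hx) (Option.some_ne_none A).symm none_notMem_circleOf
  obtain ⟨_ | B, hBM, hBD⟩ := htan.nonempty
  · exact absurd hBM none_notMem_circleOf
  rw [some_mem_circleOf] at hBM
  have hAB : A ≠ B := fun e => hBM.ne_empty (e ▸ hLM.inter_eq)
  obtain rfl : D = blockCircle A B := (h.existsUnique_circle_none hAB).unique
    ⟨hD, hnone, hA, hBD⟩ ⟨blockCircle_mem_circles hAB, none_mem_blockCircle,
      some_mem_blockCircle.2 (left_mem_blockOf A B),
      some_mem_blockCircle.2 (right_mem_blockOf A B)⟩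
  obtain ⟨z, -, hz⟩ := (h.isTangent_iff hM hLM hBM).1 htan
  exact ⟨z, hz⟩

theorem IsWilbrink.existsUnique_conjugate (h : U.IsWilbrink) (he : Even n) (hL : L ∈ U.lines)
    (hp : p ∉ L) : ∃! J : U.Pencil p, U.Conjugate J.1 L := by
  have hplane := h.isInversivePlane_circles p
  have hC := circleOf_mem_circles hL hp
  obtain ⟨_ | J, hJ⟩ := hplane.exists_areInverse he hC none_notMem_circleOf
  · exact absurd rfl hJ.ne
  refine ⟨J, (h.areInverse_iff_conjugate he hL hp).1 hJ.symm, fun J' hJ' => ?_⟩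
  exact Option.some_injective _ (AreInverse.unique hplane hC
    ((h.areInverse_iff_conjugate he hL hp).2 hJ').symm hJ)

namespace Conjugate

variable {J N : Set P}

theorem eq_of_mem (h : U.IsWilbrink) (he : Even n) (hJ : U.Conjugate J L) (hN : U.Conjugate N L)
    (hpJ : p ∈ J) (hpN : p ∈ N) : J = N :=
  congrArg Subtype.val ((h.existsUnique_conjugate he hJ.right_mem (hJ.notMem hpJ)).unique
    (y₁ := ⟨J, hJ.left_mem, hpJ⟩) (y₂ := ⟨N, hN.left_mem, hpN⟩) hJ hN)

theorem of_parallel (h : U.IsWilbrink) (he : Even n) (hJ : U.Conjugate J L) (hzJ : z ∈ J)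
    (hz : U.Parallel z L M) : U.Conjugate J M := by
  have hinv := h.areInverse_of_conjugate he (A := ⟨J, hJ.left_mem, hzJ⟩) hJ
  rw [(circleOf_eq_iff hz.left_mem hz.left_notMem hz.right_mem hz.right_notMem).2 hz] at hinv
  exact h.conjugate_of_areInverse hz.right_mem hz.right_notMem hinv

theorem parallel_of_mem_star (h : U.IsWilbrink) (he : Even n) (hM : U.Conjugate L M)
    (hM' : U.Conjugate L M') (hx : x ∈ L) (hA : A ∈ U.star x M) (hA' : A ∈ U.star x M') :
    U.Parallel x M M' := by
  have hC := circleOf_mem_circles hM.right_mem (hM.notMem hx)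
  have hC' := circleOf_mem_circles hM'.right_mem (hM'.notMem hx)
  rw [← circleOf_eq_iff hM.right_mem (hM.notMem hx) hM'.right_mem (hM'.notMem hx)]
  exact AreInverse.eq_of_mem (h.isInversivePlane_circles x) he hC hC'
    (h.areInverse_of_conjugate he (A := ⟨L, hM.left_mem, hx⟩) hM)
    (h.areInverse_of_conjugate he (A := ⟨L, hM.left_mem, hx⟩) hM') (some_mem_circleOf.2 hA)
    (some_mem_circleOf.2 hA')

theorem parallel_of_parallel (h : U.IsWilbrink) (he : Even n) (hLM : U.Conjugate L M)
    (hLJ : U.Conjugate L J) (hzJ : z ∈ J) (hz : U.Parallel z L M) (hx : x ∈ L) :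
    U.Parallel x M J := by
  obtain ⟨K, hzK, -⟩ := U.existsUnique_pencil (ne_of_mem_of_not_mem hx hz.left_notMem).symm
  exact hLM.parallel_of_mem_star h he hLJ hx ((hz.2.2 K.1 K.2.1 hzK).1 ⟨x, K.2.2, hx⟩)
    (mem_star_of_mem hzK hzJ)

theorem exists_polar (h : U.IsWilbrink) (he : Even n) (hLM : U.Conjugate L M) :
    ∃ J, U.Conjugate L J ∧ U.Conjugate M J ∧ ∀ p, U.Parallel p L M ↔ p ∈ J := by
  obtain ⟨z, -, -, hz, -⟩ := hLM.exists_parallel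
  obtain ⟨J, hJL, -⟩ := h.existsUnique_conjugate he hz.left_mem hz.left_notMem
  have hJM : U.Conjugate J.1 M := hJL.of_parallel h he J.2.2 hz
  have hMJ : ∀ x ∈ L, U.Parallel x M J.1 := fun x =>
    hLM.parallel_of_parallel h he hJL.symm J.2.2 hz
  have hLJ : ∀ y ∈ M, U.Parallel y L J.1 := fun y =>
    hLM.symm.parallel_of_parallel h he hJM.symm J.2.2 hz.symm
  have hJ : ∀ p ∈ J.1, U.Parallel p L M := by
    refine (forall_parallel_iff hLM.left_mem hLM.right_mem hJL.disjoint.symm hJM.disjoint.symm).2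
      fun K hK hKJ => ⟨fun ⟨x, hxK, hx⟩ => ?_, fun ⟨y, hyK, hy⟩ => ?_⟩
    · exact ((hMJ x hx).2.2 K hK hxK).2 hKJ
    · exact ((hLJ y hy).2.2 K hK hyK).2 hKJ
  refine ⟨J.1, hJL.symm, hJM.symm, fun p => ⟨fun hp => ?_, hJ p⟩⟩
  obtain ⟨x, hx⟩ := nonempty_of_mem_lines hLM.left_mem
  obtain ⟨K, hpK, -⟩ := U.existsUnique_pencil (ne_of_mem_of_not_mem hx hp.left_notMem).symm
  have hKL : (K.1 ∩ L).Nonempty := ⟨x, K.2.2, hx⟩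
  obtain ⟨w, hwK, hwJ⟩ :=
    ((hMJ x hx).2.2 K.1 K.2.1 K.2.2).1 ((hp.2.2 K.1 K.2.1 hpK).1 hKL)
  rwa [hp.center_unique h.two_le h.conditionI hLM.disjoint (hJ w hwJ) K.2.1 hKL hpK hwK]

end Conjugate

theorem IsWilbrink.exists_conjugate_of_disjoint (h : U.IsWilbrink) (he : Even n)
    (hL : L ∈ U.lines) (hM : M ∈ U.lines) (hLM : Disjoint L M) :
    ∃ J, U.Conjugate J L ∧ U.Conjugate J M := by
  obtain ⟨z, hz⟩ := h.exists_center he hL hM hLM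
  obtain ⟨J, hJ, -⟩ := h.existsUnique_conjugate he hL hz.left_notMem
  exact ⟨J.1, hJ, hJ.of_parallel h he J.2.2 hz⟩

theorem IsWilbrink.ncard_conjugate (h : U.IsWilbrink) (he : Even n) (hL : L ∈ U.lines) :
    {J | U.Conjugate J L}.ncard = n ^ 2 - n := by
  have := U.finite_points
  have hcount := ncard_eq_mul_of_existsUnique (S := Lᶜ) (T := {J | U.Conjugate J L})
    (C := id) (k := n + 1)
    (fun p hp => by
      obtain ⟨J, hJ, -⟩ := h.existsUnique_conjugate he hL hp
      exact ⟨J.1, ⟨hJ, J.2.2⟩, fun K ⟨hK, hpK⟩ => hK.eq_of_mem h he hJ hpK J.2.2⟩)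
    (fun J hJ => by
      rw [id, Set.inter_eq_right.2 (Set.subset_compl_iff_disjoint_right.2 hJ.disjoint),
        U.card_line J hJ.left_mem])
  rw [Set.ncard_compl, U.card_points, U.card_line L hL] at hcount
  obtain ⟨m, rfl⟩ := Nat.exists_eq_add_of_le' (Nat.le_of_succ_le h.two_le)
  have hfactor : (m + 1) ^ 3 + 1 - (m + 1 + 1) = ((m + 1) ^ 2 - (m + 1)) * (m + 1 + 1) := by
    rw [show (m + 1) ^ 2 = (m + 1) * m + (m + 1) by ring,
      show (m + 1) ^ 3 + 1 = (m + 1) * m * (m + 1 + 1) + (m + 1 + 1) by ring,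
      Nat.add_sub_cancel, Nat.add_sub_cancel]
  exact (Nat.eq_of_mul_eq_mul_right (Nat.succ_pos _) (hfactor.symm.trans hcount)).symm

namespace Conjugate

variable {J N : Set P}

theorem eq_of_conjugate (h : U.IsWilbrink) (he : Even n) (hLM : U.Conjugate L M)
    (hJL : U.Conjugate J L) (hJM : U.Conjugate J M) (hNL : U.Conjugate N L)
    (hNM : U.Conjugate N M) : J = N := by
  have := U.finite_points
  obtain ⟨p, hp⟩ := nonempty_of_mem_lines hLM.right_mem
  have := U.finite_pencil p
  have hpL : p ∉ L := hLM.symm.notMem hp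
  have hcommon : ∀ K ∈ (U.star p L)ᶜ, ∃ J, U.Conjugate J L ∧ U.Conjugate J K.1 := fun K hK =>
    h.exists_conjugate_of_disjoint he hLM.left_mem K.2.1
      (Set.disjoint_iff_inter_eq_empty.2 (Set.not_nonempty_iff_eq_empty.1 hK)).symm
  choose! f hfL hf using hcommon
  have hmaps : Set.MapsTo f (U.star p L)ᶜ ({J | U.Conjugate J L} \ {M}) := fun K hK =>
    ⟨hfL K hK, fun e => (hf K hK).symm.notMem K.2.2 (e ▸ hp)⟩
  have hinj : Set.InjOn f (U.star p L)ᶜ := fun K hK K' hK' e => Pencil.ext <|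
    (hf K hK).symm.eq_of_mem h he (e ▸ (hf K' hK').symm) K.2.2 K'.2.2
  have hcard : (U.star p L)ᶜ.ncard = ({J | U.Conjugate J L} \ {M}).ncard := by
    have hML : M ∈ {J | U.Conjugate J L} := hLM.symm
    rw [Set.ncard_sdiff_singleton_of_mem hML, h.ncard_conjugate he hLM.left_mem,
      Set.ncard_compl, card_pencil U (by have := h.two_le; omega) p,
      ncard_star hLM.left_mem hpL]
    omega
  have hsurj : ∀ G, U.Conjugate G L → U.Conjugate G M → G = f ⟨M, hLM.right_mem, hp⟩ := by
    intro G hGL hGM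
    obtain ⟨K, hK, rfl⟩ := Set.surj_on_of_inj_on_of_ncard_le (fun K _ => f K) hmaps
      (fun K K' hK hK' => hinj hK hK') hcard.ge
      (Set.toFinite _) G ⟨hGL, hGM.ne⟩
    exact congrArg f (Pencil.ext ((hf K hK).symm.eq_of_mem h he hGM.symm K.2.2 hp))
  rw [hsurj J hJL hJM, hsurj N hNL hNM]

theorem forall_parallel (h : U.IsWilbrink) (he : Even n) (hLM : U.Conjugate L M)
    (hLN : U.Conjugate L N) (hMN : U.Conjugate M N) : ∀ z ∈ N, U.Parallel z L M := by
  obtain ⟨J, hLJ, hMJ, hJ⟩ := hLM.exists_polar h he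
  obtain rfl := hLM.eq_of_conjugate h he hLJ.symm hMJ.symm hLN.symm hMN.symm
  exact fun z => (hJ z).2

end Conjugate

theorem IsWilbrink.conjugate_of_parallel (h : U.IsWilbrink) (he : Even n) {N : Set P}
    (hN : N ∈ U.lines) (hLM : Disjoint L M) (hzw : z ≠ w) (hz : z ∈ N) (hw : w ∈ N)
    (hzLM : U.Parallel z L M) (hwLM : U.Parallel w L M) :
    U.Conjugate L M ∧ U.Conjugate L N ∧ U.Conjugate M N := by
  have hconj : U.Conjugate L M := ⟨hLM, z, w, hzw, hzLM, hwLM⟩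
  obtain ⟨J, hLJ, hMJ, hJ⟩ := hconj.exists_polar h he
  obtain rfl : J = N := line_eq_of_mem hLJ.right_mem hN hzw ((hJ z).1 hzLM) ((hJ w).1 hwLM) hz hw
  exact ⟨hconj, hLJ, hMJ⟩

theorem isFlock_iff {r s : U.InvPoint x} {F : Set (Set (U.InvPoint x))} :
    U.IsFlock x r s F ↔ IsInversivePlane.IsFlock (U.circles x) r s F :=
  ⟨fun ⟨hrs, hF, hdisj, hunion⟩ => ⟨hrs, hF, hdisj, hunion⟩,
    fun ⟨hrs, hF, hdisj, hunion⟩ => ⟨hrs, hF, hdisj, hunion⟩⟩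

theorem IsWilbrink.mem_specialSpread_iff (h : U.IsWilbrink) (he : Even n) (hL : L ∈ U.lines)
    (hx : x ∈ L) : M ∈ U.specialSpread x L ↔ M = L ∨ U.Conjugate L M := by
  refine or_congr Iff.rfl ⟨?_, fun hLM => ?_⟩
  · rintro ⟨hM, hxM, hL', F, hF, hMF⟩
    obtain rfl :=
      ((h.isInversivePlane_circles x).isFlock_iff he hF.carriers_ne).1 (isFlock_iff.1 hF)
    exact h.conjugate_of_areInverse hM hxM hMF.2
  · have hxM := hLM.notMem hx
    exact ⟨hLM.right_mem, hxM, ⟨hL, hx⟩, _, isFlock_iff.2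
      (((h.isInversivePlane_circles x).isFlock_iff he (Option.some_ne_none _)).2 rfl),
      circleOf_mem_circles hLM.right_mem hxM, h.areInverse_of_conjugate he hLM⟩

theorem IsWilbrink.specialSpread_inter (h : U.IsWilbrink) (he : Even n) {N : Set P} (hx : x ∈ L)
    (hy : y ∈ M) (hLM : U.Conjugate L M) (hLN : U.Conjugate L N) (hMN : U.Conjugate M N) :
    U.specialSpread x L ∩ U.specialSpread y M = {L, M, N} := by
  ext J
  rw [Set.mem_inter_iff, h.mem_specialSpread_iff he hLM.left_mem hx,
    h.mem_specialSpread_iff he hLM.right_mem hy]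
  constructor
  · rintro ⟨rfl | hLJ, rfl | hMJ⟩
    · exact .inl rfl
    · exact .inl rfl
    · exact .inr (.inl rfl)
    · exact .inr (.inr (hLM.eq_of_conjugate h he hLJ.symm hMJ.symm hLN.symm hMN.symm))
  · rintro (rfl | rfl | rfl)
    · exact ⟨.inl rfl, .inr hLM.symm⟩
    · exact ⟨.inr hLM, .inl rfl⟩
    · exact ⟨.inr hLN, .inr hMN⟩

theorem IsWilbrink.isSelfPolarTriangle_iff (h : U.IsWilbrink) (he : Even n) {pick : Set P → P}
    (hpick : ∀ K ∈ U.lines, pick K ∈ K) {N : Set P} :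
    U.IsSelfPolarTriangle pick L M N ↔
      U.Conjugate L M ∧ U.Conjugate L N ∧ U.Conjugate M N := by
  constructor
  · rintro ⟨⟨hL, hM, -⟩, ⟨hLM, hLN, hMN⟩, heq, -, -⟩
    have hmem : ∀ J ∈ ({L, M, N} : Set (Set P)), (J = L ∨ U.Conjugate L J) ∧
        (J = M ∨ U.Conjugate M J) := fun J hJ => by
      rw [heq] at hJ
      exact ⟨(h.mem_specialSpread_iff he hL (hpick L hL)).1 hJ.1,
        (h.mem_specialSpread_iff he hM (hpick M hM)).1 hJ.2⟩
    exact ⟨(hmem M (by simp)).1.resolve_left hLM.symm,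
      (hmem N (by simp)).1.resolve_left hLN.symm, (hmem N (by simp)).2.resolve_left hMN.symm⟩
  · rintro ⟨hLM, hLN, hMN⟩
    have hL := hpick L hLM.left_mem
    have hM := hpick M hLM.right_mem
    have hN := hpick N hLN.right_mem
    refine ⟨⟨hLM.left_mem, hLM.right_mem, hLN.right_mem⟩, ⟨hLM.ne, hLN.ne, hMN.ne⟩,
      (h.specialSpread_inter he hL hM hLM hLN hMN).symm, ?_, ?_⟩
    · rw [h.specialSpread_inter he hL hN hLN hLM hMN.symm, Set.pair_comm]
    · rw [h.specialSpread_inter he hM hN hMN hLM.symm hLN.symm, Set.pair_comm N L,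
        Set.insert_comm]

theorem order_ne_zero_of_disjoint (hL : L ∈ U.lines) (hM : M ∈ U.lines) (hLM : Disjoint L M) :
    n ≠ 0 := by
  rintro rfl
  obtain ⟨p, hp⟩ := nonempty_of_mem_lines hL
  obtain ⟨q, hq⟩ := nonempty_of_mem_lines hM
  have hsub : Subsingleton P :=
    (Nat.card_eq_one_iff_unique.1 (by rw [U.card_points, zero_pow three_ne_zero])).1
  exact Set.disjoint_left.1 hLM hp (hsub.elim q p ▸ hq)

end Unital

theorem theorem2p2_general {P : Type*} {n : ℕ} (heven : Even n) (U : Unital P n)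
    (hI : U.ConditionI) (hII : U.ConditionII)
    (pick : Set P → P) (hpick : ∀ K ∈ U.lines, pick K ∈ K)
    (L M N : Set P) (hL : L ∈ U.lines) (hM : M ∈ U.lines) (hN : N ∈ U.lines)
    (hLM : Disjoint L M) (hLN : Disjoint L N) (hMN : Disjoint M N) :
    List.TFAE [
      U.IsSelfPolarTriangle pick L M N,
      ∀ z ∈ N, U.Parallel z L M,
      ∀ K ∈ U.lines,
        (((K ∩ L).Nonempty ∧ (K ∩ M).Nonempty) ∨ ((K ∩ L).Nonempty ∧ (K ∩ N).Nonempty) ∨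
          ((K ∩ M).Nonempty ∧ (K ∩ N).Nonempty)) →
        (K ∩ L).Nonempty ∧ (K ∩ M).Nonempty ∧ (K ∩ N).Nonempty,
      M ∈ U.specialSpread (pick L) L \ {L} ∧
        ∃ z₁ ∈ N, ∃ z₂ ∈ N, z₁ ≠ z₂ ∧ U.Parallel z₁ L M ∧ U.Parallel z₂ L M] := by
  have := U.finite_points
  have hn : n ≠ 0 := Unital.order_ne_zero_of_disjoint hL hM hLM
  have h : U.IsWilbrink := ⟨by obtain ⟨m, rfl⟩ := heven; omega, hI, hII⟩
  rw [h.isSelfPolarTriangle_iff heven hpick, Set.mem_sdiff,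
    h.mem_specialSpread_iff heven hL (hpick L hL)]
  tfae_have 1 → 3 := fun ⟨cLM, cLN, cMN⟩ K hK => by
    have hKN := (Unital.forall_parallel_iff hL hM hLN hMN).1 (cLM.forall_parallel h heven cLN cMN)
    have hKL := (Unital.forall_parallel_iff hM hN hLM.symm hLN.symm).1
      (cMN.forall_parallel h heven cLM.symm cLN.symm)
    have := hKN K hK
    have := hKL K hK
    tauto
  tfae_have 3 → 2 := fun h3 => (Unital.forall_parallel_iff hL hM hLN hMN).2 fun K hK hKN =>
    ⟨fun hKL => (h3 K hK (.inr (.inl ⟨hKL, hKN⟩))).2.1,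
      fun hKM => (h3 K hK (.inr (.inr ⟨hKM, hKN⟩))).1⟩
  tfae_have 2 → 4 := fun h2 => by
    obtain ⟨z, w, hz, hw, hzw⟩ := (Set.one_lt_ncard_iff).1
      (show 1 < N.ncard by rw [U.card_line N hN]; omega)
    exact ⟨⟨.inr ⟨hLM, z, w, hzw, h2 z hz, h2 w hw⟩, (Unital.ne_of_disjoint hL hLM).symm⟩,
      z, hz, w, hw, hzw, h2 z hz, h2 w hw⟩
  tfae_have 4 → 1 := fun ⟨_, z, hz, w, hw, hzw, hzLM, hwLM⟩ =>
    h.conjugate_of_parallel heven hN hLM hzw hz hw hzLM hwLM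
  tfae_finish

/-- The points at which the special spreads are constructed may be picked arbitrarily. -/
theorem theorem2p2 {P : Type*} {n : ℕ} (hn : 4 ≤ n) (heven : Even n) (U : Unital P n)
    (hI : U.ConditionI) (hII : U.ConditionII)
    (pick : Set P → P) (hpick : ∀ K ∈ U.lines, pick K ∈ K)
    (L M N : Set P) (hL : L ∈ U.lines) (hM : M ∈ U.lines) (hN : N ∈ U.lines)
    (hLM : Disjoint L M) (hLN : Disjoint L N) (hMN : Disjoint M N) :
    List.TFAE [
      U.IsSelfPolarTriangle pick L M N,
      ∀ z ∈ N, U.Parallel z L M,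
      ∀ K ∈ U.lines,
        (((K ∩ L).Nonempty ∧ (K ∩ M).Nonempty) ∨ ((K ∩ L).Nonempty ∧ (K ∩ N).Nonempty) ∨
          ((K ∩ M).Nonempty ∧ (K ∩ N).Nonempty)) →
        (K ∩ L).Nonempty ∧ (K ∩ M).Nonempty ∧ (K ∩ N).Nonempty,
      M ∈ U.specialSpread (pick L) L \ {L} ∧
        ∃ z₁ ∈ N, ∃ z₂ ∈ N, z₁ ≠ z₂ ∧ U.Parallel z₁ L M ∧ U.Parallel z₂ L M] :=
  theorem2p2_general heven U hI hII pick hpick L M N hL hM hN hLM hLN hMN
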